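/- Let $f\colon 2^{\mathcal N}\to\mathbb R_{\ge 0}$ be a non-negative monotone submodular function and let $\mathcal M=(\mathcal N,\mathcal I)$ be a matroid of rank $r$ over a finite ground set $\mathcal N$ of size $n$. Write $f(v\mid S)=f(S\cup\{v\})-f(S)$, $S-v=S\setminus\{v\}$, and let $OPT$ be a set in $\mathcal I$ maximizing $f$. An algorithm knows $\mathcal N$ and $\varepsilon$, and accesses $f$ only through a value oracle (which returns $f(S)$ for a query $S\subseteq\mathcal N$) and $\mathcal M$ only through an independence oracle (which tells whether $S\in\mathcal I$). For any $\varepsilon\in(0,1)$ consider the property $$\sum_{v\in T} f(v\mid S-v)-\sum_{u\in S} f(u\mid S-u)\ \le\ \varepsilon\cdot f(OPT)\qquad\text{for every } T\in\mathcal I. \tag{$*$}$$ Then: 1. there exists a deterministic algorithm that makes $\tilde O(\varepsilon^{-1}nr)$ value and independence oracle queries (with $r$ replaced by $1$ in this bound if $r=0$) and outputs a set $S\in\mathcal I$ satisfying $(*)$; 2. there exists a randomized algorithm that in every execution makes $\tilde O(\varepsilon^{-1}(n+r\sqrt n))$ value and independence oracle queries, that with probability at least $1-\varepsilon$ outputs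 a set $S\in\mathcal I$ satisfying $(*)$, and that otherwise outputs "Fail". Here a quantity is $\tilde O(g)$ if it is at most $C\,g\,\log^{k}(2+g)$, where $C$ and $k$ are absolute constants, which do not depend on $f$, $\mathcal M$, $n$, $r$ or $\varepsilon$. -/

import Mathlib

universe u v

/-- The marginal contribution `f(v | S) = f(S ∪ {v}) - f(S)`. -/
def marginal {α : Type u} [DecidableEq α] (f : Finset α → ℝ) (v : α) (S : Finset α) : ℝ :=
  f (insert v S) - f S

/-- Non-negative monotone submodular set functions on the subsets of a finite ground set. -/
structure IsNonnegMonotoneSubmodular {α : Type u} [DecidableEq α] (f : Finset α → ℝ) : Prop where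
  nonneg : ∀ S, 0 ≤ f S
  monotone : ∀ S T, S ⊆ T → f S ≤ f T
  submodular : ∀ S T, f (S ∩ T) + f (S ∪ T) ≤ f S + f T

/-- `OPT` is an independent set of maximum value. -/
def IsOptimal {α : Type u} (M : Matroid α) (f : Finset α → ℝ) (OPT : Finset α) : Prop :=
  M.Indep (OPT : Set α) ∧ ∀ T : Finset α, M.Indep (T : Set α) → f T ≤ f OPT

/-- `S` is independent, and for every independent `T`,
`∑_{v ∈ T} f(v | S - v) - ∑_{u ∈ S} f(u | S - u) ≤ δ`. -/
def IsApproxLocalOpt {α : Type u} [DecidableEq α] (M : Matroid α) (f : Finset α → ℝ) (δ : ℝ)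
    (S : Finset α) : Prop :=
  M.Indep (S : Set α) ∧ ∀ T : Finset α, M.Indep (T : Set α) →
    ∑ v ∈ T, marginal f v (S.erase v) - ∑ u ∈ S, marginal f u (S.erase u) ≤ δ

/-- Adaptive (possibly randomized) oracle algorithms on the ground set `α` with outputs in `β`.
An algorithm either halts with an output, or asks the value oracle for the value of a set,
or asks the independence oracle whether a set is independent, or draws a uniformly random element
of `{0, …, m}`; after the last three it continues in a way that depends on the answer. Different
branches may be arbitrarily different, but each one is finite. Everything the algorithm learns
about the function and the matroid comes from the oracle answers. -/
inductive OracleAlg (α : Type u) (β : Type v) : Type (max u v)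
  | done (b : β) : OracleAlg α β
  | value (S : Finset α) (next : ℝ → OracleAlg α β) : OracleAlg α β
  | indep (S : Finset α) (next : Bool → OracleAlg α β) : OracleAlg α β
  | coin (m : ℕ) (next : Fin (m + 1) → OracleAlg α β) : OracleAlg α β

namespace OracleAlg

/-- An algorithm is deterministic if it never uses randomness. -/
def IsDeterministic {α : Type u} {β : Type v} : OracleAlg α β → Prop
  | done _ => True
  | value _ next => ∀ x, (next x).IsDeterministic
  | indep _ next => ∀ x, (next x).IsDeterministic
  | coin _ _ => False

open Classical in
/-- The distribution of the output when the value oracle answers according to `f` and the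
independence oracle answers according to `M`. All random draws are independent. -/
noncomputable def output {α : Type u} {β : Type v} (f : Finset α → ℝ) (M : Matroid α) :
    OracleAlg α β → PMF β
  | done b => PMF.pure b
  | value S next => (next (f S)).output f M
  | indep S next => (next (decide (M.Indep (S : Set α)))).output f M
  | coin m next => (PMF.uniformOfFintype (Fin (m + 1))).bind fun i => (next i).output f M

open Classical in
/-- The total number of value and independence oracle queries made in an execution with the
oracles of `f` and `M`, in the worst case over the random draws. -/
noncomputable def queries {α : Type u} {β : Type v} (f : Finset α → ℝ) (M : Matroid α) :
    OracleAlg α β → ℕ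
  | done _ => 0
  | value S next => (next (f S)).queries f M + 1
  | indep S next => (next (decide (M.Indep (S : Set α)))).queries f M + 1
  | coin m next => Finset.univ.sup fun i : Fin (m + 1) => (next i).queries f M

end OracleAlg

/-- The bound `C g (log (2 + g))^k`: a quantity is `Õ(g)` if it is at most this for some
constants `C` and `k`. -/
noncomputable def softBound (C : ℝ) (k : ℕ) (g : ℝ) : ℝ :=
  C * g * Real.log (2 + g) ^ k

-- For a fixed base S give every element the weight w(v) = f(v | S - v). The left side of (*) then
-- compares the weight of T with that of S, and its maximum over independent T is the excess of S.
-- Two facts link excess to swaps. By submodularity, replacing u ∈ S by v ∉ S raises f by at least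
-- w(v) - w(u) (`swap_gain`). By Hall's theorem, every independent T injects into S along feasible
-- swaps (`exists_exchange_injection`), so the excess is at most a sum of |T| swap differences. A
-- best swap is cheap: with the candidates for removal sorted by weight, binary search finds the
-- lightest feasible partner of each v (`spec_improve`).
--
-- Deterministic part: perform ⌈r/ε⌉ + 1 best swaps from any base. The gains telescope to at most
-- f(OPT), so some step gains at most ε f(OPT) / r, and the base at which that step starts satisfies
-- (*). The value f(OPT) need not be known: the step of least gain is selected (`spec_localSearch`).
--
-- Randomized part: each step considers only a random block of about min(√n, r) elements of S and
-- about n divided by that many random elements. Its expected gain is at least the excess divided by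
-- 8r (`le_expect_randomStep`, `randomizedSearch_rate`). After a uniformly random number of steps
-- the expected excess is therefore a small multiple of ε f(OPT) (`sum_expect_walk_le`). The greedy
-- algorithm computes the excess exactly with O(n) queries, and S is accepted if the excess is at
-- most ε f(S); this is sound because f(S) ≤ f(OPT), and a small excess forces f(OPT) ≤ 3 f(S), so
-- good sets do pass. An attempt fails with probability at most 1/2, and logarithmically many
-- attempts reduce this to ε.

universe w

/-! ### Calculus of oracle algorithms: query counts, guaranteed outputs, expectations. -/

namespace OracleAlg

/-- Sequential composition of oracle algorithms. -/
def bind {α : Type u} {β : Type v} {γ : Type w} :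
    OracleAlg α β → (β → OracleAlg α γ) → OracleAlg α γ
  | done b, k => k b
  | value S next, k => value S fun x => (next x).bind k
  | indep S next, k => indep S fun x => (next x).bind k
  | coin m next, k => coin m fun i => (next i).bind k

open Classical in
/-- Every possible output of the algorithm satisfies `P`. -/
def Ensures {α : Type u} {β : Type v} (f : Finset α → ℝ) (M : Matroid α) (P : β → Prop) :
    OracleAlg α β → Prop
  | done b => P b
  | value S next => (next (f S)).Ensures f M P
  | indep S next => (next (decide (M.Indep (S : Set α)))).Ensures f M P
  | coin _ next => ∀ i, (next i).Ensures f M P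

open Classical in
/-- The expectation of `g` evaluated at the output of the algorithm. -/
noncomputable def expect {α : Type u} {β : Type v} (f : Finset α → ℝ) (M : Matroid α)
    (g : β → ℝ) : OracleAlg α β → ℝ
  | done b => g b
  | value S next => (next (f S)).expect f M g
  | indep S next => (next (decide (M.Indep (S : Set α)))).expect f M g
  | coin m next => (∑ i, (next i).expect f M g) / ((m : ℝ) + 1)

/-- At most `q` oracle queries are made, and every possible output satisfies `P`. -/
def Spec {α : Type u} {β : Type v} (f : Finset α → ℝ) (M : Matroid α) (q : ℕ) (P : β → Prop)
    (A : OracleAlg α β) : Prop :=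
  A.queries f M ≤ q ∧ A.Ensures f M P

section basic

variable {α : Type u} {β : Type v} {γ : Type w} {f : Finset α → ℝ} {M : Matroid α}

theorem isDeterministic_bind {A : OracleAlg α β} {k : β → OracleAlg α γ}
    (hA : A.IsDeterministic) (hk : ∀ b, (k b).IsDeterministic) : (A.bind k).IsDeterministic := by
  induction A with
  | done b => exact hk b
  | value S next ih => exact fun x => ih x (hA x)
  | indep S next ih => exact fun x => ih x (hA x)
  | coin m next ih => exact hA.elim

theorem Ensures.mono {P Q : β → Prop} {A : OracleAlg α β} (hA : A.Ensures f M P)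
    (h : ∀ b, P b → Q b) : A.Ensures f M Q := by
  induction A with
  | done b => exact h b hA
  | value S next ih => exact ih _ hA
  | indep S next ih => exact ih _ hA
  | coin m next ih => exact fun i => ih i (hA i)

theorem Spec.mono {P Q : β → Prop} {q q' : ℕ} {A : OracleAlg α β} (hA : Spec f M q P A)
    (hq : q ≤ q') (h : ∀ b, P b → Q b) : Spec f M q' Q A :=
  ⟨hA.1.trans hq, hA.2.mono h⟩

theorem Spec.done {P : β → Prop} {b : β} (q : ℕ) (hb : P b) :
    Spec f M q P (OracleAlg.done b) :=
  ⟨Nat.zero_le _, hb⟩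

theorem Spec.value {P : β → Prop} {q : ℕ} {S : Finset α} {next : ℝ → OracleAlg α β}
    (h : Spec f M q P (next (f S))) : Spec f M (q + 1) P (OracleAlg.value S next) :=
  ⟨Nat.succ_le_succ h.1, h.2⟩

open Classical in
theorem Spec.indep {P : β → Prop} {q : ℕ} {S : Finset α} {next : Bool → OracleAlg α β}
    (ht : M.Indep (S : Set α) → Spec f M q P (next true))
    (hf : ¬ M.Indep (S : Set α) → Spec f M q P (next false)) :
    Spec f M (q + 1) P (OracleAlg.indep S next) := by
  have h : Spec f M q P (next (decide (M.Indep (S : Set α)))) := by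
    by_cases hS : M.Indep (S : Set α)
    · simpa [hS] using ht hS
    · simpa [hS] using hf hS
  exact ⟨Nat.succ_le_succ h.1, h.2⟩

theorem Spec.coin {P : β → Prop} {q m : ℕ} {next : Fin (m + 1) → OracleAlg α β}
    (h : ∀ i, Spec f M q P (next i)) : Spec f M q P (OracleAlg.coin m next) :=
  ⟨Finset.sup_le fun i _ => (h i).1, fun i => (h i).2⟩

theorem Spec.bind {P : β → Prop} {Q : γ → Prop} {q q' : ℕ} {A : OracleAlg α β}
    {k : β → OracleAlg α γ} (hA : Spec f M q P A) (hk : ∀ b, P b → Spec f M q' Q (k b)) :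
    Spec f M (q + q') Q (A.bind k) := by
  induction A generalizing q with
  | done b => exact (hk b hA.2).mono (Nat.le_add_left _ _) fun _ => id
  | value S next ih =>
    obtain ⟨q, rfl⟩ := Nat.exists_eq_add_one.2 (Nat.zero_lt_of_lt hA.1)
    rw [Nat.add_right_comm]
    exact Spec.value (ih _ ⟨Nat.le_of_succ_le_succ hA.1, hA.2⟩)
  | indep S next ih =>
    obtain ⟨q, rfl⟩ := Nat.exists_eq_add_one.2 (Nat.zero_lt_of_lt hA.1)
    rw [Nat.add_right_comm]
    have := ih _ ⟨Nat.le_of_succ_le_succ hA.1, hA.2⟩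
    exact ⟨Nat.succ_le_succ this.1, this.2⟩
  | coin m next ih =>
    exact Spec.coin fun i => ih i ⟨(Finset.le_sup (f := fun i => (next i).queries f M)
      (Finset.mem_univ i)).trans hA.1, hA.2 i⟩

theorem IsDeterministic.exists_output_eq_pure {A : OracleAlg α β} (hA : A.IsDeterministic)
    {P : β → Prop} (h : A.Ensures f M P) : ∃ b, A.output f M = PMF.pure b ∧ P b := by
  induction A with
  | done b => exact ⟨b, rfl, h⟩
  | value S next ih => exact ih _ (hA _) h
  | indep S next ih => exact ih _ (hA _) h
  | coin m next ih => exact hA.elim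

theorem Ensures.of_mem_support {A : OracleAlg α β} {P : β → Prop} (h : A.Ensures f M P) {b : β}
    (hb : b ∈ (A.output f M).support) : P b := by
  induction A with
  | done b =>
    rw [output, PMF.support_pure, Set.mem_singleton_iff] at hb
    exact hb ▸ h
  | value S next ih => exact ih _ h hb
  | indep S next ih => exact ih _ h hb
  | coin m next ih =>
    rw [output, PMF.mem_support_bind_iff] at hb
    obtain ⟨i, -, hi⟩ := hb
    exact ih i (h i) hi

theorem expect_le_expect {A : OracleAlg α β} {P : β → Prop} (h : A.Ensures f M P) {g g' : β → ℝ}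
    (hg : ∀ b, P b → g b ≤ g' b) : A.expect f M g ≤ A.expect f M g' := by
  induction A with
  | done b => exact hg b h
  | value S next ih => exact ih _ h
  | indep S next ih => exact ih _ h
  | coin m next ih =>
    rw [expect, expect]
    gcongr with i
    exact ih i (h i)

theorem ensures_true (A : OracleAlg α β) : A.Ensures f M fun _ => True := by
  induction A with
  | done b => trivial
  | value S next ih => exact ih _
  | indep S next ih => exact ih _
  | coin m next ih => exact fun i => ih i

theorem expect_affine (A : OracleAlg α β) (g : β → ℝ) (a c : ℝ) :
    A.expect f M (fun b => a * g b + c) = a * A.expect f M g + c := by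
  induction A with
  | done b => rfl
  | value S next ih => exact ih _
  | indep S next ih => exact ih _
  | coin m next ih =>
    have : (m : ℝ) + 1 ≠ 0 := by positivity
    simp only [expect, ih, Finset.sum_add_distrib, ← Finset.mul_sum, Finset.sum_const,
      Finset.card_univ, Fintype.card_fin, nsmul_eq_mul, Nat.cast_add, Nat.cast_one]
    field_simp

theorem expect_const (A : OracleAlg α β) (c : ℝ) : A.expect f M (fun _ => c) = c := by
  simpa using A.expect_affine (f := f) (M := M) (fun _ => 0) 0 c

theorem expect_add (A : OracleAlg α β) (g g' : β → ℝ) :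
    A.expect f M (fun b => g b + g' b) = A.expect f M g + A.expect f M g' := by
  induction A with
  | done b => rfl
  | value S next ih => exact ih _
  | indep S next ih => exact ih _
  | coin m next ih => simp only [expect, ih, Finset.sum_add_distrib, add_div]

theorem expect_sum {ι : Type*} (A : OracleAlg α β) (s : Finset ι) (g : ι → β → ℝ) :
    A.expect f M (fun b => ∑ i ∈ s, g i b) = ∑ i ∈ s, A.expect f M (g i) := by
  classical
  induction s using Finset.induction_on with
  | empty => simpa using A.expect_const (f := f) (M := M) 0
  | insert i s hi ih => simp only [Finset.sum_insert hi, expect_add, ih]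

theorem expect_bind (A : OracleAlg α β) (k : β → OracleAlg α γ) (g : γ → ℝ) :
    (A.bind k).expect f M g = A.expect f M fun b => (k b).expect f M g := by
  induction A with
  | done b => rfl
  | value S next ih => exact ih _
  | indep S next ih => exact ih _
  | coin m next ih => simp only [bind, expect, ih]

theorem expect_nonneg {A : OracleAlg α β} {g : β → ℝ} (hg : ∀ b, 0 ≤ g b) :
    0 ≤ A.expect f M g := by
  simpa [expect_const] using expect_le_expect (ensures_true A) (f := f) (M := M)
    (g := fun _ => 0) (g' := g) fun b _ => hg b

-- The bridge from `PMF` to `expect`: all probabilistic estimates are made with real expectations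
-- and converted only at the end.
open Classical in
theorem toOuterMeasure_output (A : OracleAlg α β) (s : Set β) :
    (A.output f M).toOuterMeasure s =
      ENNReal.ofReal (A.expect f M fun b => if b ∈ s then 1 else 0) := by
  induction A with
  | done b =>
    rw [output, PMF.toOuterMeasure_pure_apply, expect]
    split_ifs <;> simp
  | value S next ih => exact ih _
  | indep S next ih => exact ih _
  | coin m next ih =>
    have h0 : ∀ i, 0 ≤ (next i).expect f M fun b => if b ∈ s then (1 : ℝ) else 0 := fun i =>
      expect_nonneg fun b => by split_ifs <;> norm_num
    rw [output, PMF.toOuterMeasure_bind_apply, tsum_fintype, expect, Finset.sum_div,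
      ENNReal.ofReal_sum_of_nonneg fun i _ => div_nonneg (h0 i) (by positivity)]
    refine Finset.sum_congr rfl fun i _ => ?_
    rw [ih, PMF.uniformOfFintype_apply, Fintype.card_fin, div_eq_inv_mul,
      ENNReal.ofReal_mul (by positivity), ENNReal.ofReal_inv_of_pos (by positivity)]
    congr 2
    rw [← Nat.cast_succ, ENNReal.ofReal_natCast]

end basic

end OracleAlg

/-! ### Basis exchange in matroids. -/

section matroid

variable {α : Type u} [DecidableEq α] {M : Matroid α} {S T : Finset α}

/-- In the fundamental circuit of `v` over `S`, every element other than `v` can be exchanged for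
`v`, and a circuit element is spanned by the rest of its circuit. -/
theorem Matroid.IsBase.mem_closure_exchangeable (hE : M.E = Set.univ) (hS : M.IsBase (S : Set α))
    {v : α} (hv : v ∉ S) :
    v ∈ M.closure {u : α | u ∈ S ∧ M.Indep (insert v (S.erase u) : Finset α)} := by
  have hvS : v ∉ (S : Set α) := by simpa using hv
  have hcl : v ∈ M.closure (S : Set α) := by rw [hS.closure_eq, hE]; trivial
  have hC := hS.fundCircuit_isCircuit (x := v) (by rw [hE]; trivial) hvS
  refine M.closure_subset_closure ?_ (hC.mem_closure_sdiff_singleton_of_mem (M.mem_fundCircuit v S))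
  rintro u ⟨huC, huv⟩
  have huS : u ∈ S := by
    rcases M.fundCircuit_subset_insert v S huC with h | h
    · exact absurd h huv
    · simpa using h
  refine ⟨huS, ?_⟩
  rw [hS.indep.mem_fundCircuit_iff hcl hvS,
    ← Set.insert_sdiff_singleton_comm (fun h => huv h.symm)] at huC
  simpa using huC

/-- Every independent set can be matched injectively into a base by feasible swaps. -/
theorem Matroid.IsBase.exists_exchange_injection (hE : M.E = Set.univ)
    (hS : M.IsBase (S : Set α)) (hT : M.Indep (T : Set α)) :
    ∃ h : α → α, Set.InjOn h T ∧ ∀ v ∈ T, h v ∈ S ∧ (v ∈ S → h v = v) ∧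
      (v ∉ S → M.Indep (insert v (S.erase (h v)) : Finset α)) := by
  classical
  -- The bipartite graph for Hall's theorem. A common element of `T` and `S` has only itself as
  -- neighbour, which forces the matching to fix it.
  let t : T → Finset α := fun v => if (v : α) ∈ S then {(v : α)} else
    S.filter fun u => M.Indep (insert (v : α) (S.erase u) : Finset α)
  have hall : ∀ V : Finset T, V.card ≤ (V.biUnion t).card := by
    intro V
    have hV : M.Indep ((V.map (Function.Embedding.subtype _) : Finset α) : Set α) :=
      hT.subset (by intro x hx; simp at hx; exact hx.1)
    have hsub : ((V.map (Function.Embedding.subtype _) : Finset α) : Set α) ⊆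
        M.closure ((V.biUnion t : Finset α) : Set α) := by
      intro x hx
      obtain ⟨hxT, hxV⟩ : ∃ hx : x ∈ T, (⟨x, hx⟩ : T) ∈ V := by simpa using hx
      have hsubt : ((t ⟨x, hxT⟩ : Finset α) : Set α) ⊆ ((V.biUnion t : Finset α) : Set α) := by
        exact_mod_cast Finset.subset_biUnion_of_mem t hxV
      refine M.closure_subset_closure hsubt ?_
      by_cases hxS : x ∈ S
      · have : t ⟨x, hxT⟩ = {x} := if_pos hxS
        rw [this]
        exact M.mem_closure_of_mem (by simp) (by rw [hE]; exact Set.subset_univ _)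
      · have : t ⟨x, hxT⟩ = S.filter fun u => M.Indep (insert x (S.erase u) : Finset α) :=
          if_neg hxS
        rw [this, Finset.coe_filter]
        exact hS.mem_closure_exchangeable hE hxS
    -- Hall's condition is a rank comparison: `V` is independent and spanned by its neighbours, so
    -- it cannot outnumber them.
    have h1 := hV.encard_le_eRk_of_subset hsub
    rw [M.eRk_closure_eq] at h1
    have h2 := h1.trans (M.eRk_le_encard _)
    rw [Set.encard_coe_eq_coe_finsetCard, Set.encard_coe_eq_coe_finsetCard, Finset.card_map] at h2
    exact_mod_cast h2
  obtain ⟨h, hinj, hh⟩ := (Finset.all_card_le_biUnion_card_iff_exists_injective t).1 hall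
  refine ⟨fun v => if hv : v ∈ T then h ⟨v, hv⟩ else v, ?_, ?_⟩
  · intro a ha b hb hab
    have ha' : a ∈ T := ha
    have hb' : b ∈ T := hb
    simp only [ha', hb', dif_pos] at hab
    simpa using hinj hab
  · intro v hv
    have := hh ⟨v, hv⟩
    simp only [dif_pos hv]
    by_cases hvS : v ∈ S
    · have h2 : h ⟨v, hv⟩ = v := by simpa [t, hvS] using this
      rw [h2]
      exact ⟨hvS, fun _ => rfl, fun h => absurd hvS h⟩
    · have h2 : h ⟨v, hv⟩ ∈ S ∧ M.Indep (insert v (S.erase (h ⟨v, hv⟩)) : Finset α) := by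
        simpa [t, hvS] using this
      exact ⟨h2.1, fun h => absurd h hvS, fun _ => h2.2⟩

/-- Elements of `S` outside the image of `h` have nonnegative weight, so dropping them only
increases the difference. -/
theorem sum_sub_sum_le_of_injOn {w : α → ℝ} (hw : ∀ v, 0 ≤ w v) {h : α → α}
    (hinj : Set.InjOn h T) (hmem : ∀ v ∈ T, h v ∈ S) :
    ∑ v ∈ T, w v - ∑ u ∈ S, w u ≤ ∑ v ∈ T, (w v - w (h v)) := by
  rw [Finset.sum_sub_distrib]
  have : ∑ v ∈ T, w (h v) ≤ ∑ u ∈ S, w u := by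
    rw [← Finset.sum_image hinj]
    exact Finset.sum_le_sum_of_subset_of_nonneg (Finset.image_subset_iff.2 hmem) fun i _ _ => hw i
  linarith

/-- If no feasible swap gains more than `d`, the base is optimal up to `d` per element. -/
theorem Matroid.IsBase.sum_sub_sum_le (hE : M.E = Set.univ) (hS : M.IsBase (S : Set α))
    (hT : M.Indep (T : Set α)) {w : α → ℝ} (hw : ∀ v, 0 ≤ w v) {d : ℝ} (hd : 0 ≤ d)
    (hopt : ∀ v ∉ S, ∀ u ∈ S, M.Indep (insert v (S.erase u) : Finset α) → w v - w u ≤ d) :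
    ∑ v ∈ T, w v - ∑ u ∈ S, w u ≤ T.card * d := by
  obtain ⟨h, hinj, hh⟩ := hS.exists_exchange_injection hE hT
  refine (sum_sub_sum_le_of_injOn hw hinj fun v hv => (hh v hv).1).trans ?_
  rw [← nsmul_eq_mul]
  refine Finset.sum_le_card_nsmul _ _ _ fun v hv => ?_
  obtain ⟨h1, h2, h3⟩ := hh v hv
  by_cases hvS : v ∈ S
  · simpa [h2 hvS] using hd
  · exact hopt v hvS _ h1 (h3 hvS)

/-- If removing `u` after `P` makes room for `v`, then `u` can be swapped for `v`. -/
theorem Matroid.IsBase.indep_swap (hE : M.E = Set.univ) (hS : M.IsBase (S : Set α)) {v u : α}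
    {X : Finset α} (hX : X ⊆ S) (huS : u ∈ S) (huX : u ∉ X) (hv : v ∉ S)
    (hdep : ¬ M.Indep (insert v (insert u X) : Finset α))
    (hind : M.Indep (insert v X : Finset α)) :
    M.Indep (insert v (S.erase u) : Finset α) := by
  have hXS : (X : Set α) ⊆ ((S.erase u : Finset α) : Set α) := by
    intro x hx
    simp only [Finset.coe_erase, Set.mem_sdiff, Finset.mem_coe, Set.mem_singleton_iff]
    exact ⟨hX hx, fun h => huX (h ▸ hx)⟩
  have hSu : M.Indep ((S.erase u : Finset α) : Set α) :=
    hS.indep.subset (by exact_mod_cast Finset.erase_subset u S)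
  have huX' : M.Indep ((insert u X : Finset α) : Set α) :=
    hS.indep.subset (by exact_mod_cast Finset.insert_subset huS hX)
  have hX' : M.Indep (X : Set α) := huX'.subset (by simp)
  have hvE : v ∈ M.E := by rw [hE]; trivial
  have huE : u ∈ M.E := by rw [hE]; trivial
  by_contra hcon
  have hvu : v ≠ u := fun h => hv (h ▸ huS)
  rw [Finset.coe_insert] at hcon hind hdep
  have h1 : v ∈ M.closure ((S.erase u : Finset α) : Set α) := by
    by_contra h
    exact hcon ((hSu.notMem_closure_iff hvE).1 h).1
  have h2 : v ∈ M.closure (insert u (X : Set α)) := by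
    by_contra h
    rw [← Finset.coe_insert] at h
    exact hdep ((huX'.notMem_closure_iff hvE).1 h).1
  have h3 : v ∉ M.closure (X : Set α) :=
    (hX'.notMem_closure_iff hvE).2 ⟨hind, fun h => hv (hX h)⟩
  -- Closure exchange puts `u` in the span of `X + v`. If the swap were infeasible, `S - u` would
  -- span `v`, hence also `u`, against the independence of `S`.
  have h4 : u ∈ M.closure (insert v (X : Set α)) := (M.closure_exchange ⟨h2, h3⟩).1
  have h5 : M.closure (insert v (X : Set α)) ⊆ M.closure ((S.erase u : Finset α) : Set α) := by
    refine M.closure_subset_closure_of_subset_closure ?_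
    rintro x (rfl | hx)
    · exact h1
    · exact M.mem_closure_of_mem (hXS hx) (by rw [hE]; exact Set.subset_univ _)
  have h6 := hS.indep.notMem_closure_sdiff_of_mem (e := u) (by exact_mod_cast huS)
  rw [Finset.coe_erase] at h5
  exact h6 (h5 h4)

theorem Matroid.IsBase.of_indep_swap (hS : M.IsBase (S : Set α)) {v u : α}
    (hv : v ∉ S) (hind : M.Indep (insert v (S.erase u) : Finset α)) :
    M.IsBase ((insert v (S.erase u) : Finset α) : Set α) := by
  have h := hS.exchange_isBase_of_indep (e := u) (f := v) (by simpa using hv) (by simpa using hind)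
  simpa using h

end matroid

/-! ### Local weights of a submodular function. -/

section submodular

variable {α : Type u} [DecidableEq α] {f : Finset α → ℝ} {M : Matroid α} {S T : Finset α}

/-- The weight `f(v | S - v)`. -/
def localWeight (f : Finset α → ℝ) (S : Finset α) (v : α) : ℝ :=
  marginal f v (S.erase v)

theorem localWeight_of_mem {u : α} (hu : u ∈ S) : localWeight f S u = f S - f (S.erase u) := by
  rw [localWeight, marginal, Finset.insert_erase hu]

theorem localWeight_of_notMem {v : α} (hv : v ∉ S) :
    localWeight f S v = f (insert v S) - f S := by
  rw [localWeight, marginal, Finset.erase_eq_of_notMem hv]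

namespace IsNonnegMonotoneSubmodular

theorem localWeight_nonneg (hf : IsNonnegMonotoneSubmodular f) (S : Finset α) (v : α) :
    0 ≤ localWeight f S v :=
  sub_nonneg.2 (hf.monotone _ _ (Finset.subset_insert _ _))

theorem marginal_anti (hf : IsNonnegMonotoneSubmodular f) (h : S ⊆ T) {v : α} (hv : v ∉ T) :
    marginal f v T ≤ marginal f v S := by
  have := hf.submodular (insert v S) T
  have h1 : insert v S ∩ T = S := by
    rw [Finset.insert_inter_of_notMem hv, Finset.inter_eq_left.2 h]
  have h2 : insert v S ∪ T = insert v T := by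
    rw [Finset.insert_union, Finset.union_eq_right.2 h]
  rw [h1, h2] at this
  unfold marginal
  linarith

/-- Removing `u` first can only increase the marginal of `v`. Weights computed once at `S` thus
bound the gain of every swap from below. -/
theorem swap_gain (hf : IsNonnegMonotoneSubmodular f) {u v : α} (hu : u ∈ S) (hv : v ∉ S) :
    f S + (localWeight f S v - localWeight f S u) ≤ f (insert v (S.erase u)) := by
  have h := hf.marginal_anti (Finset.erase_subset u S) hv
  rw [localWeight_of_mem hu, localWeight_of_notMem hv]
  unfold marginal at h
  linarith

theorem localWeight_le_singleton (hf : IsNonnegMonotoneSubmodular f) (v : α) :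
    localWeight f S v ≤ f {v} := by
  have h := hf.marginal_anti (Finset.empty_subset (S.erase v)) (v := v) (by simp)
  have h0 := hf.nonneg ∅
  simp only [marginal, insert_empty_eq] at h
  simp only [localWeight, marginal]
  linarith

theorem le_add_sum_localWeight (hf : IsNonnegMonotoneSubmodular f) (S T : Finset α) :
    f (S ∪ T) ≤ f S + ∑ v ∈ T, localWeight f S v := by
  induction T using Finset.induction_on with
  | empty => simp
  | insert v T hv ih =>
    rw [Finset.sum_insert hv, Finset.union_insert]
    by_cases hvS : v ∈ S ∪ T
    · rw [Finset.insert_eq_of_mem hvS]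
      linarith [hf.localWeight_nonneg S v]
    · have := hf.marginal_anti ((Finset.erase_subset v S).trans Finset.subset_union_left) hvS
      rw [← localWeight, marginal] at this
      linarith

/-- Build `T` one element at a time: each increment is a marginal over a subset of `S - u`, hence at
least the weight of `u`. -/
theorem sum_localWeight_le (hf : IsNonnegMonotoneSubmodular f) (h : T ⊆ S) :
    ∑ u ∈ T, localWeight f S u ≤ f T := by
  induction T using Finset.induction_on with
  | empty => simpa using hf.nonneg ∅
  | insert u T hu ih =>
    rw [Finset.insert_subset_iff] at h
    rw [Finset.sum_insert hu]
    have hsub : T ⊆ S.erase u := fun x hx =>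
      Finset.mem_erase.2 ⟨fun hxu => hu (hxu ▸ hx), h.2 hx⟩
    have := hf.marginal_anti hsub (Finset.notMem_erase u S)
    rw [← localWeight, marginal] at this
    linarith [ih h.2]

/-- The classical 1/2-approximation by local optima, with an error term: f(T) ≤ f(S ∪ T) ≤ f(S) +
w(T), while w(S) ≤ f(S). -/
theorem le_two_mul_add (hf : IsNonnegMonotoneSubmodular f) (S T : Finset α) :
    f T ≤ 2 * f S + (∑ v ∈ T, localWeight f S v - ∑ u ∈ S, localWeight f S u) := by
  have h1 := hf.le_add_sum_localWeight S T
  have h2 := hf.monotone T (S ∪ T) Finset.subset_union_right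
  have h3 := hf.sum_localWeight_le (Finset.Subset.refl S)
  linarith

end IsNonnegMonotoneSubmodular

end submodular

/-! ### Finding a best swap by sorting and binary search. -/

namespace OracleAlg

section search

variable {α : Type u} {f : Finset α → ℝ} {M : Matroid α}

/-- Binary search for a place where the sequence `X` turns from dependent to independent. -/
def search (X : ℕ → Finset α) : ℕ → ℕ → ℕ → OracleAlg α ℕ
  | 0, _, hi => done hi
  | b + 1, lo, hi => indep (X ((lo + hi) / 2)) fun t =>
      if t then search X b lo ((lo + hi) / 2) else search X b ((lo + hi) / 2) hi

theorem isDeterministic_search (X : ℕ → Finset α) (b lo hi : ℕ) :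
    (search X b lo hi).IsDeterministic := by
  induction b generalizing lo hi with
  | zero => trivial
  | succ b ih =>
    intro t
    cases t
    · exact ih _ _
    · exact ih _ _

/-- Only the invariant "dependent at `lo`, independent at `hi`" is needed, not monotonicity of `X`.
The output is the independent end of an adjacent pair. -/
theorem spec_search (X : ℕ → Finset α) (b lo hi : ℕ) (hlt : lo < hi) (hb : hi - lo ≤ 2 ^ b)
    (hlo : ¬ M.Indep (X lo : Set α)) (hhi : M.Indep (X hi : Set α)) :
    Spec f M b (fun k => ∃ j, k = j + 1 ∧ j < hi ∧ ¬ M.Indep (X j : Set α) ∧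
      M.Indep (X (j + 1) : Set α)) (search X b lo hi) := by
  induction b generalizing lo hi with
  | zero =>
    obtain rfl : hi = lo + 1 := by simp at hb; omega
    exact Spec.done _ ⟨lo, rfl, by omega, hlo, hhi⟩
  | succ b ih =>
    rw [pow_succ] at hb
    refine Spec.indep (fun h => ?_) fun h => ?_
    · have : lo ≠ (lo + hi) / 2 := fun h' => hlo (h' ▸ h)
      refine (ih lo ((lo + hi) / 2) (by omega) (by omega) hlo h).mono le_rfl ?_
      rintro k ⟨j, h1, h2, h3⟩
      exact ⟨j, h1, by omega, h3⟩
    · exact ih ((lo + hi) / 2) hi (by omega) (by omega) h hhi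

end search

section subroutines

variable {α : Type u} [DecidableEq α]

/-- Go through the list and add every element that keeps the set independent. -/
def greedy : List α → Finset α → OracleAlg α (Finset α)
  | [], I => done I
  | v :: l, I => indep (insert v I) fun b => greedy l (if b then insert v I else I)

/-- Query the value of `key u` for every `u` in the list. -/
def evalOn (key : α → Finset α) : List α → OracleAlg α (α → ℝ)
  | [] => done fun _ => 0
  | u :: l => (evalOn key l).bind fun W => value (key u) fun x => done (Function.update W u x)

/-- Find the first element of the list that can be swapped for `v`. -/
def findPartner (S : Finset α) (l : List α) (b : ℕ) (v : α) : OracleAlg α (Option α) :=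
  indep (insert v (S \ l.toFinset)) fun t =>
    if t then
      (search (fun j => insert v (S \ (l.take j).toFinset)) b 0 l.length).bind fun j =>
        done l[j - 1]?
    else done none

/-- Improve the pair `p` of a set and its value by the best swaps for the elements of a list. -/
noncomputable def bestSwap (S : Finset α) (l : List α) (b : ℕ) :
    List α → Finset α × ℝ → OracleAlg α (Finset α × ℝ)
  | [], p => done p
  | v :: vs, p =>
    if v ∈ S then bestSwap S l b vs p
    else (findPartner S l b v).bind fun o => match o with
      | none => bestSwap S l b vs p
      | some u => value (insert v (S.erase u)) fun x =>
          bestSwap S l b vs (if p.2 < x then (insert v (S.erase u), x) else p)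

/-- The best swap that removes an element of `R` and adds an element of `vs`. -/
noncomputable def improve (S R : Finset α) (b : ℕ) (vs : List α) :
    OracleAlg α (Finset α × ℝ) :=
  value S fun x => (evalOn S.erase R.toList).bind fun W =>
    bestSwap S (R.toList.mergeSort fun a c => decide (W c ≤ W a)) b vs (S, x)

theorem isDeterministic_greedy (l : List α) (I : Finset α) : (greedy l I).IsDeterministic := by
  induction l generalizing I with
  | nil => trivial
  | cons v l ih => exact fun b => ih _

theorem isDeterministic_evalOn (key : α → Finset α) (l : List α) :
    (evalOn key l).IsDeterministic := by
  induction l with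
  | nil => trivial
  | cons v l ih => exact isDeterministic_bind ih fun _ _ => trivial

theorem isDeterministic_findPartner (S : Finset α) (l : List α) (b : ℕ) (v : α) :
    (findPartner S l b v).IsDeterministic := by
  intro t
  cases t
  · trivial
  · exact isDeterministic_bind (isDeterministic_search _ _ _ _) fun _ => trivial

theorem isDeterministic_bestSwap (S : Finset α) (l : List α) (b : ℕ) (vs : List α)
    (p : Finset α × ℝ) : (bestSwap S l b vs p).IsDeterministic := by
  induction vs generalizing p with
  | nil => trivial
  | cons v vs ih =>
    rw [bestSwap]
    split_ifs
    · exact ih _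
    · refine isDeterministic_bind (isDeterministic_findPartner _ _ _ _) fun o => ?_
      cases o with
      | none => exact ih _
      | some u => exact fun x => ih _

theorem isDeterministic_improve (S R : Finset α) (b : ℕ) (vs : List α) :
    (improve S R b vs).IsDeterministic :=
  fun _ => isDeterministic_bind (isDeterministic_evalOn _ _) fun _ =>
    isDeterministic_bestSwap _ _ _ _ _

variable {f : Finset α → ℝ} {M : Matroid α} {S R : Finset α}

/-- The witness `P` for a rejected `v` is the set held at the moment of rejection; since the list is
sorted by decreasing weight, its members are at least as heavy as `v`. This certificate yields both
maximality and optimality of the greedy set. -/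
theorem spec_greedy (w : α → ℝ) (l : List α) (I : Finset α) (hI : M.Indep (I : Set α))
    (hw : ∀ u ∈ I, ∀ v ∈ l, w v ≤ w u) (hl : l.Pairwise fun a c => w c ≤ w a) :
    Spec f M l.length (fun G => I ⊆ G ∧ M.Indep (G : Set α) ∧ ∀ v ∈ l, v ∉ G →
      ∃ P ⊆ G, (∀ u ∈ P, w v ≤ w u) ∧ ¬ M.Indep ((insert v P : Finset α) : Set α))
      (greedy l I) := by
  induction l generalizing I with
  | nil => exact Spec.done _ ⟨subset_rfl, hI, by simp⟩
  | cons v l ih =>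
    rw [List.pairwise_cons] at hl
    refine Spec.indep (fun h => ?_) fun h => ?_
    · refine (ih (insert v I) h ?_ hl.2).mono le_rfl ?_
      · intro u hu a ha
        rcases Finset.mem_insert.1 hu with rfl | hu
        · exact hl.1 a ha
        · exact hw u hu a (List.mem_cons_of_mem _ ha)
      · rintro G ⟨h1, h2, h3⟩
        refine ⟨(Finset.subset_insert _ _).trans h1, h2, fun a ha haG => ?_⟩
        rcases List.mem_cons.1 ha with rfl | ha
        · exact absurd (h1 (Finset.mem_insert_self _ _)) haG
        · exact h3 a ha haG
    · refine (ih I hI (fun u hu a ha => hw u hu a (List.mem_cons_of_mem _ ha)) hl.2).mono le_rfl ?_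
      rintro G ⟨h1, h2, h3⟩
      refine ⟨h1, h2, fun a ha haG => ?_⟩
      rcases List.mem_cons.1 ha with rfl | ha
      · exact ⟨I, h1, fun u hu => hw u hu _ (List.mem_cons_self), h⟩
      · exact h3 a ha haG

theorem spec_evalOn (key : α → Finset α) (l : List α) :
    Spec f M l.length (fun W => ∀ u ∈ l, W u = f (key u)) (evalOn key l) := by
  induction l with
  | nil => exact Spec.done _ (by simp)
  | cons v l ih =>
    refine Spec.bind ih fun W hW => Spec.value (q := 0) (Spec.done _ fun u hu => ?_)
    by_cases huv : u = v
    · simp [huv]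
    · rw [Function.update_of_ne huv]
      exact hW u ((List.mem_cons.1 hu).resolve_left huv)

/-- Delete growing prefixes of `l`, sorted by increasing weight, from `S`. The element whose
deletion first seen by the search makes room for `v` is a feasible partner. An earlier feasible one
would already make the shorter deletion independent, so it is a lightest one. -/
theorem spec_findPartner (hE : M.E = Set.univ) (hS : M.IsBase (S : Set α)) {l : List α}
    (hlS : ∀ u ∈ l, u ∈ S) (hnd : l.Nodup) {w : α → ℝ} (hl : l.Pairwise fun a c => w a ≤ w c)
    {b : ℕ} (hb : l.length ≤ 2 ^ b) {v : α} (hv : v ∉ S) :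
    Spec f M (b + 1) (fun o => (o = none ∧
        ∀ u ∈ l, ¬ M.Indep ((insert v (S.erase u) : Finset α) : Set α)) ∨
      ∃ u, o = some u ∧ u ∈ l ∧ M.Indep ((insert v (S.erase u) : Finset α) : Set α) ∧
        ∀ u' ∈ l, M.Indep ((insert v (S.erase u') : Finset α) : Set α) → w u ≤ w u')
      (findPartner S l b v) := by
  have hdep : ¬ M.Indep ((insert v S : Finset α) : Set α) := by
    rw [Finset.coe_insert]
    exact (hS.insert_dep ⟨by rw [hE]; trivial, by simpa using hv⟩).not_indep
  have hsub : ∀ {u : α} {Y : Finset α}, u ∈ Y →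
      ((insert v (S \ Y) : Finset α) : Set α) ⊆ ((insert v (S.erase u) : Finset α) : Set α) := by
    intro u Y hu
    refine Finset.coe_subset.2 (Finset.insert_subset_insert v fun x hx => ?_)
    rw [Finset.mem_sdiff] at hx
    exact Finset.mem_erase.2 ⟨fun h => hx.2 (h ▸ hu), hx.1⟩
  refine Spec.indep (fun h => ?_) fun h => ?_
  · have hpos : 0 < l.length := by
      rcases l with _ | ⟨a, l⟩
      · simp only [List.toFinset_nil, Finset.sdiff_empty] at h
        exact absurd h hdep
      · simp
    refine Spec.bind (spec_search (fun j => insert v (S \ (l.take j).toFinset)) b 0 l.length hpos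
      (by simpa using hb) (by simpa using hdep) (by simpa using h)) ?_ (q' := 0)
    rintro k ⟨j, rfl, hj, hnot, hind⟩
    refine Spec.done _ (Or.inr ⟨l[j], by simp [hj], List.getElem_mem hj, ?_, ?_⟩)
    · have htake : (l.take (j + 1)).toFinset = insert l[j] (l.take j).toFinset := by
        rw [List.take_succ_eq_append_getElem hj]
        ext x
        simp only [List.mem_toFinset, Finset.mem_insert, List.mem_append, List.mem_singleton,
          or_comm]
      have hnotin : l[j] ∉ (l.take j).toFinset := by
        rw [List.mem_toFinset, List.mem_take_iff_getElem]
        rintro ⟨i, hi, h⟩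
        have := (List.Nodup.getElem_inj_iff hnd).1 h
        omega
      have hins : insert l[j] (S \ (l.take (j + 1)).toFinset) = S \ (l.take j).toFinset := by
        rw [htake]
        ext x
        simp only [Finset.mem_insert, Finset.mem_sdiff, not_or]
        constructor
        · rintro (rfl | h)
          · exact ⟨hlS _ (List.getElem_mem hj), hnotin⟩
          · exact ⟨h.1, h.2.2⟩
        · rintro ⟨h1, h2⟩
          by_cases hx : x = l[j]
          · exact Or.inl hx
          · exact Or.inr ⟨h1, hx, h2⟩
      refine hS.indep_swap hE (X := S \ (l.take (j + 1)).toFinset) Finset.sdiff_subset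
        (hlS _ (List.getElem_mem hj)) ?_ hv ?_ hind
      · rw [htake]
        simp
      · rw [hins]
        exact hnot
    · intro u' hu' hu'ind
      obtain ⟨i, hi, rfl⟩ := List.getElem_of_mem hu'
      by_cases hij : i < j
      · refine absurd (hu'ind.subset (hsub ?_)) hnot
        rw [List.mem_toFinset, List.mem_take_iff_getElem]
        exact ⟨i, by omega, rfl⟩
      · rcases (not_lt.1 hij).eq_or_lt with rfl | hlt
        · exact le_rfl
        · exact List.pairwise_iff_getElem.1 hl j i hj hi hlt
  · refine (Spec.done b (Or.inl ⟨rfl, fun u hu hcon => h (hcon.subset (hsub ?_))⟩))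
    simpa using hu

/-- The algorithm compares true values of f, whereas the guarantee is in terms of weights. For each
`v` the lightest partner dominates all others, and `swap_gain` passes from weights to values. -/
theorem spec_bestSwap (hf : IsNonnegMonotoneSubmodular f) (hE : M.E = Set.univ)
    (hS : M.IsBase (S : Set α)) {l : List α} (hlS : ∀ u ∈ l, u ∈ S) (hnd : l.Nodup)
    (hl : l.Pairwise fun a c => localWeight f S a ≤ localWeight f S c)
    {b : ℕ} (hb : l.length ≤ 2 ^ b) (vs : List α) (p : Finset α × ℝ)
    (hp : M.IsBase (p.1 : Set α)) (hpf : p.2 = f p.1) :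
    Spec f M (vs.length * (b + 2)) (fun p' => M.IsBase (p'.1 : Set α) ∧ p'.2 = f p'.1 ∧
      p.2 ≤ p'.2 ∧ ∀ v ∈ vs, v ∉ S → ∀ u ∈ l,
        M.Indep ((insert v (S.erase u) : Finset α) : Set α) →
          f S + (localWeight f S v - localWeight f S u) ≤ p'.2) (bestSwap S l b vs p) := by
  induction vs generalizing p with
  | nil => exact Spec.done _ ⟨hp, hpf, le_rfl, by simp⟩
  | cons v vs ih =>
    rw [bestSwap]
    have hlen : (v :: vs).length * (b + 2) = (b + 1) + (vs.length * (b + 2) + 1) := by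
      simp; ring
    rw [hlen]
    split_ifs with hv
    · refine (ih p hp hpf).mono (by omega) ?_
      rintro p' ⟨h1, h2, h3, h4⟩
      refine ⟨h1, h2, h3, fun a ha haS => ?_⟩
      rcases List.mem_cons.1 ha with rfl | ha
      · exact absurd hv haS
      · exact h4 a ha haS
    · refine Spec.bind (spec_findPartner hE hS hlS hnd hl hb hv) ?_
      rintro o (⟨rfl, hnone⟩ | ⟨u, rfl, hul, hind, hmin⟩)
      · refine (ih p hp hpf).mono (by omega) ?_
        rintro p' ⟨h1, h2, h3, h4⟩
        refine ⟨h1, h2, h3, fun a ha haS u hu hi => ?_⟩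
        rcases List.mem_cons.1 ha with rfl | ha
        · exact absurd hi (hnone u hu)
        · exact h4 a ha haS u hu hi
      · refine Spec.value ?_
        have key : ∀ q : Finset α × ℝ, M.IsBase (q.1 : Set α) → q.2 = f q.1 → p.2 ≤ q.2 →
            f (insert v (S.erase u)) ≤ q.2 →
            Spec f M (vs.length * (b + 2)) (fun p' => M.IsBase (p'.1 : Set α) ∧ p'.2 = f p'.1 ∧
              p.2 ≤ p'.2 ∧ ∀ v' ∈ v :: vs, v' ∉ S → ∀ u ∈ l,
                M.Indep ((insert v' (S.erase u) : Finset α) : Set α) →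
                  f S + (localWeight f S v' - localWeight f S u) ≤ p'.2)
              (bestSwap S l b vs q) := by
          intro q hq1 hq2 hpq hvq
          refine (ih q hq1 hq2).mono le_rfl ?_
          rintro p' ⟨h1, h2, h3, h4⟩
          refine ⟨h1, h2, hpq.trans h3, fun a ha haS u' hu' hi => ?_⟩
          rcases List.mem_cons.1 ha with rfl | ha
          · have := hf.swap_gain (hlS u hul) hv
            have := hmin u' hu' hi
            linarith
          · exact h4 a ha haS u' hu' hi
        split_ifs with hlt
        · exact key _ (hS.of_indep_swap hv hind) rfl hlt.le le_rfl
        · exact key _ hp hpf le_rfl (not_lt.1 hlt)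

theorem spec_improve (hf : IsNonnegMonotoneSubmodular f) (hE : M.E = Set.univ)
    (hS : M.IsBase (S : Set α)) (hR : R ⊆ S) {b : ℕ} (hb : R.card ≤ 2 ^ b) (vs : List α) :
    Spec f M (R.card + vs.length * (b + 2) + 1) (fun p => M.IsBase (p.1 : Set α) ∧
      p.2 = f p.1 ∧ f S ≤ p.2 ∧ ∀ v ∈ vs, v ∉ S → ∀ u ∈ R,
        M.Indep ((insert v (S.erase u) : Finset α) : Set α) →
          f S + (localWeight f S v - localWeight f S u) ≤ p.2) (improve S R b vs) := by
  refine Spec.value (Spec.bind ((spec_evalOn S.erase R.toList).mono (Finset.length_toList R).le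
    fun _ => id) fun W hW => ?_)
  have hperm := List.mergeSort_perm R.toList fun a c => decide (W c ≤ W a)
  have hsort := List.pairwise_mergeSort (le := fun a c => decide (W c ≤ W a))
    (by simp only [decide_eq_true_eq]; exact fun a b c h1 h2 => h2.trans h1)
    (by simp only [Bool.or_eq_true, decide_eq_true_eq]; exact fun a b => le_total _ _) R.toList
  have hmem : ∀ u, u ∈ R.toList.mergeSort (fun a c => decide (W c ≤ W a)) ↔ u ∈ R := fun u => by
    rw [hperm.mem_iff, Finset.mem_toList]
  refine (spec_bestSwap hf hE hS (fun u hu => hR ((hmem u).1 hu))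
    (hperm.nodup_iff.2 R.nodup_toList) ?_ (by rw [hperm.length_eq, Finset.length_toList]; exact hb)
    vs (S, f S) hS rfl).mono le_rfl ?_
  -- For u ∈ S the weight is f(S) - f(S - u), so decreasing f(S - u) is the same order as increasing
  -- weight.
  · refine hsort.imp_of_mem fun {a c} ha hc h => ?_
    have ha' := (hmem a).1 ha
    have hc' := (hmem c).1 hc
    rw [decide_eq_true_eq, hW a (by simpa using ha'), hW c (by simpa using hc')] at h
    rw [localWeight_of_mem (hR ha'), localWeight_of_mem (hR hc')]
    linarith
  · rintro p ⟨h1, h2, h3, h4⟩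
    exact ⟨h1, h2, h3, fun v hv hvS u hu => h4 v hv hvS u ((hmem u).2 hu)⟩

end subroutines

end OracleAlg

/-! ### Logarithmic estimates and criteria for near-optimality. -/

section bounds

theorem one_le_log_two_add {g : ℝ} (hg : 1 ≤ g) : 1 ≤ Real.log (2 + g) := by
  rw [Real.le_log_iff_exp_le (by linarith)]
  linarith [Real.exp_one_lt_d9]

/-- The rounded-up logarithm is at most log(2 + g) / log 2 + 1; the factor 3 absorbs both 1 / log 2
and the added 1. -/
theorem clog_le_log_two_add {g : ℝ} (hg : 1 ≤ g) {n : ℕ} (hn : (n : ℝ) ≤ 2 + g) :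
    (Nat.clog 2 n : ℝ) ≤ 3 * Real.log (2 + g) := by
  have hL := one_le_log_two_add hg
  rcases Nat.lt_or_ge 1 n with h | h
  · have h1 : 2 ^ (Nat.clog 2 n - 1) < n := Nat.pow_pred_clog_lt_self one_lt_two h
    have hpos : 0 < Nat.clog 2 n := Nat.clog_pos one_lt_two h
    have h2 : ((2 : ℝ) ^ (Nat.clog 2 n - 1)) ≤ 2 + g := by
      refine le_trans ?_ hn
      exact_mod_cast h1.le
    have h3 := Real.log_le_log (by positivity) h2
    rw [Real.log_pow, Nat.cast_sub hpos, Nat.cast_one] at h3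
    have h4 := Real.log_two_gt_d9
    have h5 : (1 : ℝ) ≤ Nat.clog 2 n := by exact_mod_cast hpos
    nlinarith
  · rw [Nat.clog_of_right_le_one h]
    simp only [Nat.cast_zero]
    linarith

end bounds

section matroid

theorem Matroid.IsBase.finset_card_eq {α : Type u} {M : Matroid α} {S : Finset α} {r : ℕ}
    (hS : M.IsBase (S : Set α)) (hr : M.eRank = (r : ℕ∞)) : S.card = r := by
  have := hS.encard_eq_eRank
  rw [hr, Set.encard_coe_eq_coe_finsetCard] at this
  exact_mod_cast this

theorem Matroid.Indep.finset_card_le {α : Type u} {M : Matroid α} {T : Finset α} {r : ℕ}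
    (hT : M.Indep (T : Set α)) (hr : M.eRank = (r : ℕ∞)) : T.card ≤ r := by
  have := hT.encard_le_eRank
  rw [hr, Set.encard_coe_eq_coe_finsetCard] at this
  exact_mod_cast this

theorem exists_isOptimal {α : Type u} [Fintype α] (f : Finset α → ℝ) (M : Matroid α) :
    ∃ OPT : Finset α, IsOptimal M f OPT := by
  classical
  obtain ⟨T, hT, hmax⟩ := Finset.exists_max_image
    (Finset.univ.filter fun T : Finset α => M.Indep (T : Set α)) f ⟨∅, by simp⟩
  exact ⟨T, by simpa using hT, fun T' hT' => hmax T' (by simpa using hT')⟩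

variable {α : Type u} [DecidableEq α] {f : Finset α → ℝ} {M : Matroid α} {S T : Finset α}

theorem isApproxLocalOpt_of_swap_gain_le (hf : IsNonnegMonotoneSubmodular f)
    (hE : M.E = Set.univ) {r : ℕ} (hr : M.eRank = (r : ℕ∞)) (hS : M.IsBase (S : Set α)) {d δ : ℝ}
    (hd : 0 ≤ d) (hδ : r * d ≤ δ)
    (hopt : ∀ v ∉ S, ∀ u ∈ S, M.Indep ((insert v (S.erase u) : Finset α) : Set α) →
      localWeight f S v - localWeight f S u ≤ d) :
    IsApproxLocalOpt M f δ S := by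
  refine ⟨hS.indep, fun T hT => ?_⟩
  refine (hS.sum_sub_sum_le hE hT (hf.localWeight_nonneg S) hd hopt).trans (le_trans ?_ hδ)
  have : (T.card : ℝ) ≤ r := by exact_mod_cast hT.finset_card_le hr
  gcongr

theorem isApproxLocalOpt_of_rank_zero (hf : IsNonnegMonotoneSubmodular f) (hE : M.E = Set.univ)
    (hr : M.eRank = ((0 : ℕ) : ℕ∞)) (hS : M.IsBase (S : Set α)) {δ : ℝ} (hδ : 0 ≤ δ) :
    IsApproxLocalOpt M f δ S := by
  have h0 : S = ∅ := Finset.card_eq_zero.1 (hS.finset_card_eq hr)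
  exact isApproxLocalOpt_of_swap_gain_le hf hE hr hS le_rfl (by simpa using hδ) (by simp [h0])

theorem isBase_of_forall_not_indep_insert (hS : M.Indep (S : Set α))
    (h : ∀ v, v ∉ S → ∃ P ⊆ S, ¬ M.Indep ((insert v P : Finset α) : Set α)) :
    M.IsBase (S : Set α) := by
  refine hS.isBase_of_forall_insert fun v hv => ?_
  obtain ⟨P, hPS, hP⟩ := h v (by simpa using hv.2)
  refine fun hcon => hP (hcon.subset ?_)
  rw [← Finset.coe_insert]
  exact_mod_cast Finset.insert_subset_insert v hPS

end matroid

/-! ### The deterministic algorithm. -/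

namespace OracleAlg

section deterministic

variable {α : Type u} [Fintype α] [DecidableEq α]

/-- Find some base. -/
noncomputable def findBase (α : Type u) [Fintype α] [DecidableEq α] : OracleAlg α (Finset α) :=
  greedy Finset.univ.toList ∅

/-- Make `k + 1` best swaps, starting from `S`; return the set at which the gain was smallest,
together with this gain. -/
noncomputable def localSearch (b : ℕ) : ℕ → Finset α → OracleAlg α (Finset α × ℝ)
  | 0, S => value S fun x => (improve S S b Finset.univ.toList).bind fun p => done (S, p.2 - x)
  | k + 1, S => value S fun x => (improve S S b Finset.univ.toList).bind fun p =>
      (localSearch b k p.1).bind fun q => done (if p.2 - x ≤ q.2 then (S, p.2 - x) else q)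

/-- The deterministic algorithm. -/
noncomputable def deterministicSearch (α : Type u) [Fintype α] [DecidableEq α] (ε : ℝ) :
    OracleAlg α (Finset α) :=
  (findBase α).bind fun B =>
    (localSearch (Nat.clog 2 (Fintype.card α)) ⌈B.card / ε⌉₊ B).bind fun q => done q.1

theorem isDeterministic_localSearch (b k : ℕ) (S : Finset α) :
    (localSearch b k S).IsDeterministic := by
  induction k generalizing S with
  | zero => exact fun _ => isDeterministic_bind (isDeterministic_improve _ _ _ _) fun _ => trivial
  | succ k ih =>
    exact fun _ => isDeterministic_bind (isDeterministic_improve _ _ _ _) fun _ =>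
      isDeterministic_bind (ih _) fun _ => trivial

theorem isDeterministic_deterministicSearch (ε : ℝ) :
    (deterministicSearch α ε).IsDeterministic :=
  isDeterministic_bind (isDeterministic_greedy _ _) fun _ =>
    isDeterministic_bind (isDeterministic_localSearch _ _ _) fun _ => trivial

variable {f : Finset α → ℝ} {M : Matroid α} {S : Finset α}

theorem spec_findBase :
    Spec f M (Fintype.card α) (fun B : Finset α => M.IsBase (B : Set α)) (findBase α) := by
  refine (spec_greedy (fun _ => 0) Finset.univ.toList ∅ (by simp) (by simp) ?_).mono (by simp) ?_
  · exact List.pairwise_of_forall fun _ _ => le_rfl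
  · rintro G ⟨-, hG, h⟩
    refine isBase_of_forall_not_indep_insert hG fun v hv => ?_
    obtain ⟨P, h1, -, h2⟩ := h v (by simp) hv
    exact ⟨P, h1, h2⟩

/-- The `k + 1` gains telescope to at most `V - f S`, and the returned `q.2` is the least of them.
It bounds all swap differences at `q.1`, because the best swap there gained no more. -/
theorem spec_localSearch (hf : IsNonnegMonotoneSubmodular f) (hE : M.E = Set.univ) {b : ℕ}
    (hb : Fintype.card α ≤ 2 ^ b) {V : ℝ} (hV : ∀ T : Finset α, M.Indep (T : Set α) → f T ≤ V)
    (k : ℕ) (S : Finset α) (hS : M.IsBase (S : Set α)) :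
    Spec f M ((k + 1) * (Fintype.card α * (b + 3) + 2))
      (fun q => M.IsBase (q.1 : Set α) ∧ 0 ≤ q.2 ∧ f S + (k + 1) * q.2 ≤ V ∧
        ∀ v ∉ q.1, ∀ u ∈ q.1, M.Indep ((insert v (q.1.erase u) : Finset α) : Set α) →
          localWeight f q.1 v - localWeight f q.1 u ≤ q.2) (localSearch b k S) := by
  have himp : ∀ S : Finset α, M.IsBase (S : Set α) →
      Spec f M (Fintype.card α * (b + 3) + 1) (fun p => M.IsBase (p.1 : Set α) ∧
        p.2 = f p.1 ∧ f S ≤ p.2 ∧ ∀ v ∉ S, ∀ u ∈ S,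
          M.Indep ((insert v (S.erase u) : Finset α) : Set α) →
            localWeight f S v - localWeight f S u ≤ p.2 - f S)
        (improve S S b Finset.univ.toList) := fun S hS => by
    have hcard : S.card ≤ Fintype.card α := Finset.card_le_univ S
    refine (spec_improve hf hE hS subset_rfl (hcard.trans hb) _).mono ?_ ?_
    · rw [Finset.length_toList, Finset.card_univ]
      linarith
    · rintro p ⟨h1, h2, h3, h4⟩
      exact ⟨h1, h2, h3, fun v hv u hu hi => by linarith [h4 v (by simp) hv u hu hi]⟩
  induction k generalizing S with
  | zero =>
    have hlen : (0 + 1) * (Fintype.card α * (b + 3) + 2) =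
        (Fintype.card α * (b + 3) + 1) + 0 + 1 := by ring
    rw [hlen]
    refine Spec.value (Spec.bind (q := Fintype.card α * (b + 3) + 1) (q' := 0) (himp S hS) ?_)
    rintro p ⟨h1, h2, h3, h4⟩
    refine Spec.done _ ⟨hS, by simpa using h3, ?_, h4⟩
    have := hV p.1 h1.indep
    simp only [Nat.cast_zero]
    linarith
  | succ k ih =>
    have hlen : (k + 1 + 1) * (Fintype.card α * (b + 3) + 2) =
        (Fintype.card α * (b + 3) + 1) + ((k + 1) * (Fintype.card α * (b + 3) + 2) + 0) + 1 := by
      ring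
    rw [hlen]
    refine Spec.value (Spec.bind (himp S hS) ?_)
    rintro p ⟨h1, h2, h3, h4⟩
    refine Spec.bind (ih p.1 h1) ?_
    rintro q ⟨hq1, hq2, hq3, hq4⟩
    refine Spec.done _ ?_
    have hk : (0 : ℝ) ≤ k := Nat.cast_nonneg k
    rw [Nat.cast_succ]
    split_ifs with hle
    · refine ⟨hS, by simpa using h3, ?_, h4⟩
      simp only
      nlinarith
    · refine ⟨hq1, hq2, ?_, hq4⟩
      nlinarith

theorem spec_deterministicSearch (hf : IsNonnegMonotoneSubmodular f) (hE : M.E = Set.univ) {r : ℕ}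
    (hr : M.eRank = (r : ℕ∞)) {ε : ℝ} (hε : 0 < ε) :
    Spec f M (Fintype.card α + (⌈r / ε⌉₊ + 1) *
        (Fintype.card α * (Nat.clog 2 (Fintype.card α) + 3) + 2))
      (fun S => ∀ OPT : Finset α, IsOptimal M f OPT → IsApproxLocalOpt M f (ε * f OPT) S)
      (deterministicSearch α ε) := by
  obtain ⟨OPT, hOPT⟩ := exists_isOptimal f M
  refine Spec.bind spec_findBase fun B hB => ?_
  rw [hB.finset_card_eq hr]
  refine Spec.bind (q' := 0)
    (spec_localSearch hf hE (Nat.le_pow_clog one_lt_two _) hOPT.2 _ B hB) ?_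
  rintro q ⟨h1, h2, h3, h4⟩
  refine Spec.done _ fun OPT' hOPT' => ?_
  -- All optimal sets have the same value, so a bound obtained for one serves for every other.
  rw [le_antisymm (hOPT.2 _ hOPT'.1) (hOPT'.2 _ hOPT.1)]
  refine isApproxLocalOpt_of_swap_gain_le hf hE hr h1 h2 ?_ h4
  have h5 : (r : ℝ) / ε ≤ ⌈r / ε⌉₊ := Nat.le_ceil _
  rw [div_le_iff₀ hε] at h5
  have h6 := hf.nonneg B
  calc (r : ℝ) * q.2 ≤ (⌈r / ε⌉₊ * ε) * q.2 := by gcongr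
    _ = ε * (⌈r / ε⌉₊ * q.2) := by ring
    _ ≤ ε * f OPT := by gcongr; linarith

/-- There are at most 3 max(r, 1) / ε steps of cost at most n(b + 5) ≤ 8nL, where L is the
logarithm; with the initial base this gives 25 = 1 + 3 · 8. -/
theorem deterministicSearch_bound {n r : ℕ} (hn : 0 < n) {ε : ℝ} (hε : 0 < ε) (hε1 : ε < 1) :
    ((n + (⌈r / ε⌉₊ + 1) * (n * (Nat.clog 2 n + 3) + 2) : ℕ) : ℝ) ≤
      softBound 25 1 (ε⁻¹ * ((n : ℝ) * (max r 1 : ℕ))) := by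
  set R : ℝ := ((max r 1 : ℕ) : ℝ) with hR
  have hR1 : 1 ≤ R := by rw [hR]; exact_mod_cast le_max_right r 1
  have hrR : (r : ℝ) ≤ R := by rw [hR]; exact_mod_cast le_max_left r 1
  have hn1 : (1 : ℝ) ≤ n := by exact_mod_cast hn
  have hi1 : 1 ≤ ε⁻¹ := (one_le_inv₀ hε).2 hε1.le
  set g : ℝ := ε⁻¹ * (n * R) with hg
  have hng : (n : ℝ) ≤ g := by
    have h1 : (n : ℝ) ≤ n * R := le_mul_of_one_le_right (by linarith) hR1
    have h2 : n * R ≤ ε⁻¹ * (n * R) := le_mul_of_one_le_left (by nlinarith) hi1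
    linarith
  have hg1 : 1 ≤ g := hn1.trans hng
  have hL := one_le_log_two_add hg1
  have hb := clog_le_log_two_add hg1 (n := n) (by linarith)
  have hb0 : (0 : ℝ) ≤ Nat.clog 2 n := Nat.cast_nonneg _
  rw [softBound, pow_one]
  set L := Real.log (2 + g)
  set b : ℝ := (Nat.clog 2 n : ℝ)
  have hN : (⌈r / ε⌉₊ : ℝ) + 1 ≤ 3 * (ε⁻¹ * R) := by
    have h1 : (⌈r / ε⌉₊ : ℝ) < r / ε + 1 := Nat.ceil_lt_add_one (by positivity)
    have h2 : r / ε ≤ ε⁻¹ * R := by rw [div_eq_inv_mul]; gcongr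
    have h3 : 1 ≤ ε⁻¹ * R := one_le_mul_of_one_le_of_one_le hi1 hR1
    linarith
  push_cast
  calc (n : ℝ) + (⌈r / ε⌉₊ + 1) * (n * (b + 3) + 2)
      ≤ g + 3 * (ε⁻¹ * R) * (n * (b + 3) + 2 * n) := by gcongr; linarith
    _ = g + 3 * g * (b + 5) := by rw [hg]; ring
    _ ≤ g * L + 3 * g * (3 * L + 5 * L) := by
        have : g ≤ g * L := le_mul_of_one_le_right (by linarith) hL
        gcongr
        linarith
    _ = 25 * g * L := by ring

end deterministic

end OracleAlg

/-! ### The excess and its exact verification. -/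

section excess

variable {α : Type u} [Fintype α] [DecidableEq α] {f : Finset α → ℝ} {M : Matroid α}
  {S T : Finset α}

open Classical in
/-- The largest value of `∑_{v ∈ T} f(v | S - v) - ∑_{u ∈ S} f(u | S - u)` over independent `T`. -/
noncomputable def excess (f : Finset α → ℝ) (M : Matroid α) (S : Finset α) : ℝ :=
  (Finset.univ.filter fun T : Finset α => M.Indep (T : Set α)).sup' ⟨∅, by simp⟩
    fun T => ∑ v ∈ T, localWeight f S v - ∑ u ∈ S, localWeight f S u

theorem le_excess (S : Finset α) (hT : M.Indep (T : Set α)) :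
    ∑ v ∈ T, localWeight f S v - ∑ u ∈ S, localWeight f S u ≤ excess f M S := by
  classical
  exact Finset.le_sup' (fun T => ∑ v ∈ T, localWeight f S v - ∑ u ∈ S, localWeight f S u)
    (by simpa using hT)

theorem exists_eq_excess (f : Finset α → ℝ) (M : Matroid α) (S : Finset α) :
    ∃ T : Finset α, M.Indep (T : Set α) ∧
      excess f M S = ∑ v ∈ T, localWeight f S v - ∑ u ∈ S, localWeight f S u := by
  classical
  obtain ⟨T, hT, h⟩ := Finset.exists_mem_eq_sup'
    (s := Finset.univ.filter fun T : Finset α => M.Indep (T : Set α)) ⟨∅, by simp⟩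
    fun T => ∑ v ∈ T, localWeight f S v - ∑ u ∈ S, localWeight f S u
  exact ⟨T, by simpa using hT, h⟩

theorem excess_nonneg (hS : M.Indep (S : Set α)) : 0 ≤ excess f M S := by
  simpa using le_excess (f := f) S hS

theorem isApproxLocalOpt_of_excess_le {δ : ℝ} (hS : M.Indep (S : Set α))
    (h : excess f M S ≤ δ) : IsApproxLocalOpt M f δ S :=
  ⟨hS, fun _ hT => (le_excess S hT).trans h⟩

theorem excess_le_zero (hf : IsNonnegMonotoneSubmodular f) {OPT : Finset α}
    (hOPT : IsOptimal M f OPT) (h0 : f OPT = 0) : excess f M S ≤ 0 := by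
  obtain ⟨T, hT, h⟩ := exists_eq_excess f M S
  have h1 : ∑ v ∈ T, localWeight f S v ≤ 0 := Finset.sum_nonpos fun v hv => by
    refine (hf.localWeight_le_singleton v).trans (h0 ▸ hOPT.2 {v} (hT.subset ?_))
    simpa using hv
  have h2 : 0 ≤ ∑ u ∈ S, localWeight f S u :=
    Finset.sum_nonneg fun u _ => hf.localWeight_nonneg S u
  linarith

/-- A set whose excess is small compared to the optimum is a constant approximation. -/
theorem excess_le_mul_self (hf : IsNonnegMonotoneSubmodular f) {OPT : Finset α}
    (hOPT : M.Indep (OPT : Set α)) {ε : ℝ} (hε : 0 ≤ ε) (hε1 : ε ≤ 1)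
    (h : excess f M S ≤ ε / 3 * f OPT) : excess f M S ≤ ε * f S := by
  -- Here f(OPT) ≤ 2 f(S) + f(OPT) / 3, hence f(OPT) ≤ 3 f(S).
  have h1 := hf.le_two_mul_add S OPT
  have h2 := le_excess (f := f) S hOPT
  have h3 : ε / 3 * f OPT ≤ 1 / 3 * f OPT :=
    mul_le_mul_of_nonneg_right (by linarith) (hf.nonneg OPT)
  have h4 : ε / 3 * f OPT ≤ ε / 3 * (3 * f S) :=
    mul_le_mul_of_nonneg_left (by linarith) (by linarith)
  linarith

end excess

namespace OracleAlg

section verify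

variable {α : Type u} [Fintype α] [DecidableEq α]

/-- Compute a set of maximum weight and use it to check that the excess of `S` is small. -/
noncomputable def verify (ε : ℝ) (S : Finset α) : OracleAlg α (Option (Finset α)) :=
  value S fun x => (evalOn (fun v => insert v (S.erase v)) Finset.univ.toList).bind fun W =>
    (evalOn (fun v => S.erase v) Finset.univ.toList).bind fun W' =>
      (greedy (Finset.univ.toList.mergeSort fun a c => decide (W c - W' c ≤ W a - W' a)) ∅).bind
        fun G => done (if ∑ v ∈ G, (W v - W' v) - ∑ u ∈ S, (W u - W' u) ≤ ε * x
          then some S else none)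

variable {f : Finset α → ℝ} {M : Matroid α} {S : Finset α}

/-- No swap improves a greedy base: if `u` lies in the witness `P` it is at least as heavy as `v`,
and otherwise `P` survives the removal of `u` and blocks `v`. The exchange bound with `d = 0` then
shows that `G` has maximum weight. -/
theorem excess_eq_of_greedy (hf : IsNonnegMonotoneSubmodular f) (hE : M.E = Set.univ)
    {G : Finset α} (hG : M.Indep (G : Set α))
    (h : ∀ v, v ∉ G → ∃ P ⊆ G, (∀ u ∈ P, localWeight f S v ≤ localWeight f S u) ∧
      ¬ M.Indep ((insert v P : Finset α) : Set α)) :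
    excess f M S = ∑ v ∈ G, localWeight f S v - ∑ u ∈ S, localWeight f S u := by
  have hbase : M.IsBase (G : Set α) := isBase_of_forall_not_indep_insert hG fun v hv => by
    obtain ⟨P, h1, -, h2⟩ := h v hv
    exact ⟨P, h1, h2⟩
  refine le_antisymm ?_ (le_excess S hG)
  obtain ⟨T, hT, hex⟩ := exists_eq_excess f M S
  have := hbase.sum_sub_sum_le hE hT (hf.localWeight_nonneg S) le_rfl fun v hv u _ hi => by
    obtain ⟨P, h1, h2, h3⟩ := h v hv
    by_cases hu' : u ∈ P
    · linarith [h2 u hu']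
    · refine absurd (hi.subset (Finset.coe_subset.2 (Finset.insert_subset_insert v ?_))) h3
      exact fun x hx => Finset.mem_erase.2 ⟨fun hxu => hu' (hxu ▸ hx), h1 hx⟩
  rw [mul_zero] at this
  linarith

theorem spec_verify (hf : IsNonnegMonotoneSubmodular f) (hE : M.E = Set.univ) (ε : ℝ)
    (S : Finset α) :
    Spec f M (3 * Fintype.card α + 1) (fun o => o = if excess f M S ≤ ε * f S then some S else none)
      (verify ε S) := by
  have hlen : 3 * Fintype.card α + 1 = (Fintype.card α + (Fintype.card α +
    (Fintype.card α + 0))) + 1 := by ring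
  have hcard : (Finset.univ : Finset α).toList.length ≤ Fintype.card α := by simp
  rw [hlen]
  refine Spec.value (Spec.bind ((spec_evalOn _ _).mono hcard fun _ => id) fun W hW =>
    Spec.bind ((spec_evalOn _ _).mono hcard fun _ => id) fun W' hW' => ?_)
  have hw : ∀ v, W v - W' v = localWeight f S v := fun v => by
    rw [hW v (by simp), hW' v (by simp)]
    rfl
  simp only [hw]
  have hperm := List.mergeSort_perm (Finset.univ : Finset α).toList
    fun a c => decide (localWeight f S c ≤ localWeight f S a)
  have hsort := List.pairwise_mergeSort
    (le := fun a c => decide (localWeight f S c ≤ localWeight f S a))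
    (by simp only [decide_eq_true_eq]; exact fun a b c h1 h2 => h2.trans h1)
    (by simp only [Bool.or_eq_true, decide_eq_true_eq]; exact fun a b => le_total _ _)
    (Finset.univ : Finset α).toList
  simp only [decide_eq_true_eq] at hsort
  refine Spec.bind ((spec_greedy (localWeight f S) _ ∅ (by simp) (by simp) hsort).mono
    (hperm.length_eq.trans_le hcard) fun _ => id) ?_
  rintro G ⟨-, hG, h⟩
  refine Spec.done _ ?_
  rw [excess_eq_of_greedy hf hE hG fun v hv => h v (hperm.mem_iff.2 (by simp)) hv]

end verify

/-! ### The expected maximum of independent samples. -/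

section peak

variable {α : Type u}

/-- The largest value of `z` on a list, and at least `0`. -/
noncomputable def peak (z : α → ℝ) : List α → ℝ
  | [] => 0
  | v :: l => max (z v) (peak z l)

theorem peak_le {z : α → ℝ} {l : List α} {c : ℝ} (hc : 0 ≤ c) (h : ∀ v ∈ l, z v ≤ c) :
    peak z l ≤ c := by
  induction l with
  | nil => exact hc
  | cons v l ih =>
    exact max_le (h v List.mem_cons_self) (ih fun a ha => h a (List.mem_cons_of_mem _ ha))

end peak

section sampling

variable {α : Type u} [Fintype α]

/-- A uniformly random element of the ground set. -/
noncomputable def uniform [Nonempty α] : OracleAlg α α :=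
  coin (Fintype.card α - 1) fun i => done ((Fintype.equivFin α).symm
    (Fin.cast (Nat.sub_add_cancel Fintype.card_pos) i))

/-- A list of `k` independent uniformly random elements of the ground set. -/
noncomputable def sample [Nonempty α] : ℕ → OracleAlg α (List α)
  | 0 => done []
  | k + 1 => uniform.bind fun v => (sample k).bind fun l => done (v :: l)

variable [Nonempty α] {f : Finset α → ℝ} {M : Matroid α}

theorem expect_uniform (g : α → ℝ) :
    (uniform : OracleAlg α α).expect f M g = (∑ v, g v) / Fintype.card α := by
  have hpos : 0 < Fintype.card α := Fintype.card_pos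
  rw [uniform, expect]
  congr 1
  · exact Equiv.sum_comp ((finCongr (Nat.sub_add_cancel hpos)).trans
      (Fintype.equivFin α).symm) g
  · rw [Nat.cast_sub hpos]
    simp

theorem spec_sample (k : ℕ) : Spec f M 0 (fun l : List α => l.length = k) (sample k) := by
  induction k with
  | zero => exact Spec.done _ rfl
  | succ k ih =>
    refine Spec.bind (q := 0) (q' := 0) (P := fun _ => True)
      (Spec.coin fun i => Spec.done _ trivial) fun v _ => ?_
    exact Spec.bind (q := 0) (q' := 0) ih fun l hl => Spec.done _ (by simp [hl])

open Classical in
/-- The expected maximum of `k` independent samples, for a function with small support. -/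
theorem le_expect_peak {z : α → ℝ} (hz : ∀ v, 0 ≤ z v) {s : ℕ}
    (hs : (Finset.univ.filter fun v => z v ≠ 0).card = s) (k : ℕ) :
    (k - (s : ℝ) / Fintype.card α * (k * (k - 1) / 2)) * ((∑ v, z v) / Fintype.card α) ≤
      (sample k).expect f M (peak z) := by
  have hn : (0 : ℝ) < Fintype.card α := by exact_mod_cast Fintype.card_pos
  have hsn : s ≤ Fintype.card α := hs ▸ Finset.card_le_univ _
  set n : ℝ := ((Fintype.card α : ℕ) : ℝ)
  have hsn' : (s : ℝ) ≤ n := Nat.cast_le.2 hsn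
  set Z : ℝ := (∑ v, z v) / n
  have hZ : 0 ≤ Z := div_nonneg (Finset.sum_nonneg fun v _ => hz v) hn.le
  have hq : (s : ℝ) / n ≤ 1 := (div_le_one hn).2 hsn'
  have hq0 : 0 ≤ (s : ℝ) / n := by positivity
  induction k with
  | zero => simp [sample, expect, peak]
  | succ k ih =>
    set e : ℝ := (sample k).expect f M (peak z)
    -- Condition on the first sample: off the support, which has probability 1 - s/n, the earlier
    -- peak counts; on the support, the value of `z` itself counts.
    have hstep : (1 - s / n) * e + Z ≤ (sample (k + 1)).expect f M (peak z) := by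
      rw [sample, expect_bind, expect_uniform]
      have h1 : ∀ v, z v + (if z v = 0 then e else 0) ≤
          ((sample k).bind fun l => done (v :: l)).expect f M (peak z) := by
        intro v
        rw [expect_bind]
        simp only [expect, peak]
        split_ifs with h0
        · rw [h0, zero_add]
          exact expect_le_expect (ensures_true _) fun l _ => le_max_right _ _
        · rw [add_zero]
          calc z v = (sample k).expect f M fun _ => z v := (expect_const _ _).symm
            _ ≤ _ := expect_le_expect (ensures_true _) fun l _ => le_max_left _ _
      have h2 : (∑ v, (z v + if z v = 0 then e else 0)) = ∑ v, z v + (n - s) * e := by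
        rw [Finset.sum_add_distrib, ← Finset.sum_filter, Finset.sum_const, nsmul_eq_mul]
        congr 2
        have := Finset.card_filter_add_card_filter_not (s := (Finset.univ : Finset α))
          fun v => z v = 0
        rw [hs, Finset.card_univ] at this
        rw [eq_sub_iff_add_eq, ← Nat.cast_add]
        exact congrArg _ this
      calc (1 - s / n) * e + Z = (∑ v, z v + (n - s) * e) / n := by
            simp only [Z]
            field_simp
            ring
        _ ≤ _ := by
            rw [← h2]
            gcongr with v
            exact h1 v
    refine le_trans ?_ hstep
    have h3 := mul_le_mul_of_nonneg_left ih (sub_nonneg.2 hq)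
    refine le_trans ?_ (add_le_add_left h3 Z)
    have hk : 0 ≤ (k : ℝ) * (k - 1) := by
      rcases k with _ | k
      · simp
      · push_cast; ring_nf; positivity
    -- The quadratic term in s/n produced by the recursion; being nonnegative, it can be dropped.
    have h4 : 0 ≤ (s / n) * (s / n) * (k * (k - 1) / 2) * Z := by positivity
    push_cast
    nlinarith

/-- When s · k ≤ n, collisions in the support cost at most half of the linear term. -/
theorem half_mul_le_expect_peak {z : α → ℝ} (hz : ∀ v, 0 ≤ z v) {s : ℕ} {X : Finset α}
    (hX : ∀ v, z v ≠ 0 → v ∈ X) (hs : X.card ≤ s) {k : ℕ} (hsk : s * k ≤ Fintype.card α) :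
    (k : ℝ) / 2 * ((∑ v, z v) / Fintype.card α) ≤ (sample k).expect f M (peak z) := by
  classical
  have hn : (0 : ℝ) < Fintype.card α := by exact_mod_cast Fintype.card_pos
  refine le_trans ?_ (le_expect_peak hz rfl k)
  have hcard : (Finset.univ.filter fun v => z v ≠ 0).card ≤ s :=
    (Finset.card_le_card fun v hv => hX v (by simpa using hv)).trans hs
  refine mul_le_mul_of_nonneg_right ?_
    (div_nonneg (Finset.sum_nonneg fun v _ => hz v) hn.le)
  set c := (Finset.univ.filter fun v => z v ≠ 0).card
  have h1 : (c : ℝ) * k ≤ Fintype.card α := by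
    exact_mod_cast (Nat.mul_le_mul_right k hcard).trans hsk
  have h2 : (c : ℝ) / Fintype.card α * k ≤ 1 := by
    rw [div_mul_eq_mul_div, div_le_one hn]
    exact h1
  rcases k with _ | k
  · simp
  · have hk : (0 : ℝ) ≤ k := Nat.cast_nonneg k
    push_cast at h2 ⊢
    nlinarith

end sampling

end OracleAlg

/-! ### Blocks, independent repetition and the random walk of swaps. -/

namespace OracleAlg

section block

variable {α : Type u} [DecidableEq α]

/-- The `i`-th block in a partition of `S` into blocks of at most `t` elements. -/
noncomputable def block (S : Finset α) (t i : ℕ) : Finset α :=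
  S.filter fun u => ∃ h : u ∈ S, (S.equivFin ⟨u, h⟩ : ℕ) / t = i

theorem card_block_le (S : Finset α) {t : ℕ} (ht : 0 < t) (i : ℕ) : (block S t i).card ≤ t := by
  have h := Finset.card_le_card_of_injOn (s := block S t i)
    (t := Finset.Ico (i * t) (i * t + t))
    (fun u => if h : u ∈ S then (S.equivFin ⟨u, h⟩ : ℕ) else 0) ?_ ?_
  · simpa using h
  · intro u hu
    obtain ⟨-, hS, hu⟩ := Finset.mem_filter.1 hu
    simp only [hS, dif_pos, Finset.coe_Ico, Set.mem_Ico]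
    have h1 := Nat.div_add_mod (S.equivFin ⟨u, hS⟩ : ℕ) t
    have h2 := Nat.mod_lt (S.equivFin ⟨u, hS⟩ : ℕ) ht
    rw [hu, mul_comm] at h1
    omega
  · intro u hu v hv huv
    have hu := (Finset.mem_filter.1 hu).1
    have hv := (Finset.mem_filter.1 hv).1
    simp only [hu, hv, dif_pos] at huv
    have := S.equivFin.injective (Fin.ext huv)
    simpa using this

theorem exists_mem_block {S : Finset α} {t m : ℕ} (hm : S.card ≤ (m + 1) * t) {u : α}
    (hu : u ∈ S) : ∃ i : Fin (m + 1), u ∈ block S t i :=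
  ⟨⟨(S.equivFin ⟨u, hu⟩ : ℕ) / t, Nat.div_lt_of_lt_mul
    (((S.equivFin ⟨u, hu⟩).2.trans_le hm).trans_eq (mul_comm _ _))⟩,
    Finset.mem_filter.2 ⟨hu, hu, rfl⟩⟩

end block

section retry

variable {α : Type u} {f : Finset α → ℝ} {M : Matroid α}

/-- Repeat an algorithm until it succeeds, at most `K` times. -/
def retry (A : OracleAlg α (Option (Finset α))) : ℕ → OracleAlg α (Option (Finset α))
  | 0 => done none
  | K + 1 => A.bind fun o => match o with
      | none => retry A K
      | some S => done (some S)

/-- The indicator of failure. -/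
def failure (o : Option (Finset α)) : ℝ :=
  o.elim 1 fun _ => 0

theorem spec_retry {A : OracleAlg α (Option (Finset α))} {q : ℕ} {P : Finset α → Prop}
    (hA : Spec f M q (fun o => o = none ∨ ∃ S, o = some S ∧ P S) A) (K : ℕ) :
    Spec f M (K * q) (fun o => o = none ∨ ∃ S, o = some S ∧ P S) (retry A K) := by
  induction K with
  | zero => exact Spec.done _ (Or.inl rfl)
  | succ K ih =>
    rw [Nat.succ_mul, add_comm]
    refine Spec.bind hA ?_
    rintro o (rfl | ⟨S, rfl, hS⟩)
    · exact ih
    · exact Spec.done _ (Or.inr ⟨S, rfl, hS⟩)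

theorem expect_failure_retry_le {A : OracleAlg α (Option (Finset α))} {p : ℝ} (hp : 0 ≤ p)
    (hA : A.expect f M failure ≤ p) (K : ℕ) : (retry A K).expect f M failure ≤ p ^ K := by
  induction K with
  | zero => simp [retry, expect, failure]
  | succ K ih =>
    have h0 : 0 ≤ (retry A K).expect f M failure := expect_nonneg fun o => by
      cases o
      · exact zero_le_one
      · exact le_rfl
    rw [retry, expect_bind, pow_succ]
    calc A.expect f M _ ≤ A.expect f M
          (fun o => (retry A K).expect f M failure * failure o + 0) := by
          refine expect_le_expect (ensures_true A) fun o _ => ?_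
          cases o
          · simp [failure]
          · simp [failure, expect]
      _ = (retry A K).expect f M failure * A.expect f M failure := by rw [expect_affine, add_zero]
      _ ≤ p ^ K * p := mul_le_mul ih hA (expect_nonneg fun o => by
          cases o
          · exact zero_le_one
          · exact le_rfl) (by positivity)

end retry

section randomized

variable {α : Type u} [Fintype α] [DecidableEq α]

variable [Nonempty α]

/-- The best swap between a random block of `S` and `k` random elements. -/
noncomputable def randomStep (b t m k : ℕ) (S : Finset α) : OracleAlg α (Finset α) :=
  coin m fun i => (sample k).bind fun l =>
    (improve S (block S t i) b l).bind fun p => done p.1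

/-- Make `j` random steps. -/
noncomputable def walk (b t m k : ℕ) : ℕ → Finset α → OracleAlg α (Finset α)
  | 0, S => done S
  | j + 1, S => (randomStep b t m k S).bind (walk b t m k j)

/-- Make a random number of random steps, and check the result. -/
noncomputable def attempt (ε : ℝ) (b t m k N : ℕ) (B : Finset α) :
    OracleAlg α (Option (Finset α)) :=
  coin N fun j => (walk b t m k j B).bind (verify ε)

/-- The randomized algorithm. -/
noncomputable def randomizedSearch (α : Type u) [Fintype α] [DecidableEq α] [Nonempty α] (ε : ℝ) :
    OracleAlg α (Option (Finset α)) :=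
  (findBase α).bind fun B =>
    if B.card = 0 then done (some B)
    else retry (attempt ε (Nat.clog 2 (Fintype.card α))
      (min (Fintype.card α).sqrt B.card) (B.card / min (Fintype.card α).sqrt B.card)
      (Fintype.card α / min (Fintype.card α).sqrt B.card) ⌈48 * B.card / ε⌉₊ B)
      (Nat.clog 2 ⌈ε⁻¹⌉₊)

variable {f : Finset α → ℝ} {M : Matroid α} {S : Finset α}

theorem spec_randomStep (hf : IsNonnegMonotoneSubmodular f) (hE : M.E = Set.univ)
    (hS : M.IsBase (S : Set α)) {b t : ℕ} (hb : Fintype.card α ≤ 2 ^ b) (ht : 0 < t) (m k : ℕ) :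
    Spec f M (t + k * (b + 2) + 1) (fun S' : Finset α => M.IsBase (S' : Set α))
      (randomStep b t m k S) := by
  refine Spec.coin fun i => ?_
  have h0 : t + k * (b + 2) + 1 = 0 + ((t + k * (b + 2) + 1) + 0) := by ring
  rw [h0]
  refine Spec.bind (spec_sample k) fun l hl => Spec.bind (P := fun p : Finset α × ℝ =>
    M.IsBase (p.1 : Set α)) ((spec_improve hf hE hS (Finset.filter_subset _ _)
      ((Finset.card_le_univ _).trans hb) l).mono ?_ fun p hp => hp.1) fun p hp => Spec.done _ hp
  rw [hl]
  have := card_block_le S ht i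
  gcongr
  exact this

/-- Match a set `T` attaining the excess into `S` by an injection `h`. Neither is known to the
algorithm, but the best swap is at least as good as any matched swap sampled. As `h` is injective,
at most `t` elements are matched into one block, so k ≤ n/t samples collect at least k/(2n) of the
block's positive gains; averaging over the `m + 1` blocks recovers the whole excess. -/
theorem le_expect_randomStep (hf : IsNonnegMonotoneSubmodular f) (hE : M.E = Set.univ)
    (hS : M.IsBase (S : Set α)) {b t m k : ℕ} (hb : Fintype.card α ≤ 2 ^ b) (ht : 0 < t)
    (hm : S.card ≤ (m + 1) * t) (htk : t * k ≤ Fintype.card α) :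
    f S + (k : ℝ) / (2 * Fintype.card α * (m + 1)) * excess f M S ≤
      (randomStep b t m k S).expect f M f := by
  obtain ⟨T, hT, hex⟩ := exists_eq_excess f M S
  obtain ⟨h, hinj, hh⟩ := hS.exists_exchange_injection hE hT
  classical
  let z : Fin (m + 1) → α → ℝ := fun i v =>
    if v ∈ T ∧ h v ∈ block S t i then max 0 (localWeight f S v - localWeight f S (h v)) else 0
  have hz : ∀ i v, 0 ≤ z i v := fun i v => by
    simp only [z]
    split_ifs
    · exact le_max_left _ _
    · exact le_rfl
  have hpeak : ∀ (i : Fin (m + 1)) l,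
      ((improve S (block S t i) b l).bind fun p => done p.1).expect f M f ≥
        1 * peak (z i) l + f S := by
    intro i l
    rw [expect_bind, ge_iff_le, one_mul,
      ← expect_const (f := f) (M := M) (improve S (block S t i) b l) (peak (z i) l + f S)]
    refine expect_le_expect (spec_improve hf hE hS (Finset.filter_subset _ _)
      ((Finset.card_le_univ _).trans hb) l).2 ?_
    rintro p ⟨-, h2, h3, h4⟩
    have : peak (z i) l ≤ p.2 - f S := by
      refine peak_le (by linarith) fun v hv => ?_
      simp only [z]
      split_ifs with hvT
      · refine max_le (by linarith) ?_
        obtain ⟨h5, h6, h7⟩ := hh v hvT.1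
        by_cases hvS : v ∈ S
        · rw [h6 hvS]
          linarith
        · linarith [h4 v hv hvS (h v) hvT.2 (h7 hvS)]
      · linarith
    change _ ≤ f p.1
    linarith
  have hblock : ∀ i : Fin (m + 1), f S + (k : ℝ) / 2 * ((∑ v, z i v) / Fintype.card α) ≤
      ((sample k).bind fun l =>
        (improve S (block S t i) b l).bind fun p => done p.1).expect f M f := by
    intro i
    rw [expect_bind]
    refine le_trans ?_ (expect_le_expect (ensures_true _) fun l _ => hpeak i l)
    rw [expect_affine, one_mul, add_comm]
    refine add_le_add_left (half_mul_le_expect_peak (hz i) (s := t)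
      (X := T.filter fun v => h v ∈ block S t i) ?_ ?_ htk) _
    · intro v hv
      simp only [z, ne_eq, ite_eq_right_iff, not_forall] at hv
      obtain ⟨hv, -⟩ := hv
      exact Finset.mem_filter.2 hv
    · refine le_trans (Finset.card_le_card_of_injOn h (t := block S t i) ?_ ?_)
        (card_block_le S ht i)
      · exact fun v hv => (Finset.mem_filter.1 hv).2
      · exact hinj.mono fun v hv => (Finset.mem_filter.1 hv).1
  have hsum : excess f M S ≤ ∑ i, ∑ v, z i v := by
    rw [hex]
    refine (sum_sub_sum_le_of_injOn (hf.localWeight_nonneg S) hinj fun v hv => (hh v hv).1).trans ?_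
    rw [Finset.sum_comm]
    calc ∑ v ∈ T, (localWeight f S v - localWeight f S (h v))
        ≤ ∑ v ∈ T, ∑ i, z i v := by
          refine Finset.sum_le_sum fun v hv => ?_
          obtain ⟨i, hi⟩ := exists_mem_block hm (hh v hv).1
          refine le_trans ?_ (Finset.single_le_sum (fun i _ => hz i v) (Finset.mem_univ i))
          simp only [z, if_pos (And.intro hv hi)]
          exact le_max_right _ _
      _ ≤ ∑ v, ∑ i, z i v := Finset.sum_le_univ_sum_of_nonneg fun v =>
          Finset.sum_nonneg fun i _ => hz i v
  have hn : (0 : ℝ) < Fintype.card α := by exact_mod_cast Fintype.card_pos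
  rw [randomStep, expect]
  calc f S + (k : ℝ) / (2 * Fintype.card α * (m + 1)) * excess f M S
      ≤ f S + (k : ℝ) / (2 * Fintype.card α * (m + 1)) * ∑ i, ∑ v, z i v := by gcongr
    _ = (∑ i : Fin (m + 1), (f S + (k : ℝ) / 2 * ((∑ v, z i v) / Fintype.card α))) / (m + 1) := by
        rw [Finset.sum_add_distrib, ← Finset.mul_sum, ← Finset.sum_div, Finset.sum_const,
          Finset.card_univ, Fintype.card_fin, nsmul_eq_mul]
        push_cast
        field_simp
    _ ≤ _ := by
        gcongr with i
        exact hblock i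

theorem spec_walk (hf : IsNonnegMonotoneSubmodular f) (hE : M.E = Set.univ)
    {b t : ℕ} (hb : Fintype.card α ≤ 2 ^ b) (ht : 0 < t) (m k j : ℕ) (S : Finset α)
    (hS : M.IsBase (S : Set α)) :
    Spec f M (j * (t + k * (b + 2) + 1)) (fun S' : Finset α => M.IsBase (S' : Set α))
      (walk b t m k j S) := by
  induction j generalizing S with
  | zero => exact Spec.done _ hS
  | succ j ih =>
    rw [Nat.succ_mul, add_comm]
    exact Spec.bind (spec_randomStep hf hE hS hb ht m k) fun S' hS' => ih S' hS'

/-- Potential argument with f as potential: each step gains in expectation at least `κ` times the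
current excess, and the total gain cannot exceed `V - f S`. The induction peels off the first step.
-/
theorem sum_expect_walk_le (hf : IsNonnegMonotoneSubmodular f) (hE : M.E = Set.univ) {r : ℕ}
    (hr : M.eRank = (r : ℕ∞)) {b t m k : ℕ} (hb : Fintype.card α ≤ 2 ^ b) (ht : 0 < t)
    (hm : r ≤ (m + 1) * t) (htk : t * k ≤ Fintype.card α) {κ V : ℝ}
    (hκ : κ ≤ (k : ℝ) / (2 * Fintype.card α * (m + 1)))
    (hV : ∀ T : Finset α, M.Indep (T : Set α) → f T ≤ V) (N : ℕ) (S : Finset α)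
    (hS : M.IsBase (S : Set α)) :
    κ * ∑ j ∈ Finset.range N, (walk b t m k j S).expect f M (excess f M) ≤ V - f S := by
  induction N generalizing S with
  | zero => simpa using hV S hS.indep
  | succ N ih =>
    rw [Finset.sum_range_succ']
    simp only [walk, expect_bind]
    rw [← expect_sum, mul_add]
    have h1 : κ * (randomStep b t m k S).expect f M (fun S' =>
        ∑ j ∈ Finset.range N, (walk b t m k j S').expect f M (excess f M)) ≤
        -1 * (randomStep b t m k S).expect f M f + V := by
      rw [← expect_affine, ← add_zero (κ * _), ← expect_affine]
      exact expect_le_expect (spec_randomStep hf hE hS hb ht m k).2 fun S' hS' => by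
        linarith [ih S' hS']
    have h2 := le_expect_randomStep hf hE hS hb ht
      ((hS.finset_card_eq hr).trans_le hm) htk
    have h3 := mul_le_mul_of_nonneg_right hκ (excess_nonneg (f := f) hS.indep)
    change _ + κ * excess f M S ≤ _
    linarith

/-- Markov's inequality at a random stopping time. The average expected excess is at most V / (κ(N +
1)), rejection requires an excess above εV/3, and the 6 in `hN` makes the quotient at most 1/2. -/
theorem expect_failure_attempt_le (hf : IsNonnegMonotoneSubmodular f) (hE : M.E = Set.univ) {r : ℕ}
    (hr : M.eRank = (r : ℕ∞)) {b t m k : ℕ} (hb : Fintype.card α ≤ 2 ^ b) (ht : 0 < t)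
    (hm : r ≤ (m + 1) * t) (htk : t * k ≤ Fintype.card α) {ε κ : ℝ} (hκ0 : 0 < κ)
    (hκ : κ ≤ (k : ℝ) / (2 * Fintype.card α * (m + 1))) (hε : 0 < ε) (hε1 : ε < 1) {N : ℕ}
    (hN : 6 ≤ κ * ε * (N + 1)) (hS : M.IsBase (S : Set α)) :
    (attempt ε b t m k N S).expect f M failure ≤ 1 / 2 := by
  obtain ⟨OPT, hOPT⟩ := exists_isOptimal f M
  set V := f OPT with hVdef
  have hV0 : 0 ≤ V := hf.nonneg OPT
  have hver : ∀ S : Finset α, M.IsBase (S : Set α) →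
      (verify ε S).expect f M failure ≤ 3 / (ε * V) * excess f M S := by
    intro S hS
    have h0 := excess_nonneg (f := f) hS.indep
    have hle : (verify ε S).expect f M failure ≤
        if excess f M S ≤ ε * f S then 0 else 1 := by
      rw [← expect_const (f := f) (M := M) (verify ε S) (if excess f M S ≤ ε * f S then 0 else 1)]
      refine expect_le_expect (spec_verify hf hE ε S).2 ?_
      rintro o rfl
      split_ifs <;> exact le_rfl
    refine hle.trans ?_
    split_ifs with hex
    · positivity
    · have hnot : ε / 3 * V < excess f M S := by
        by_contra hcon
        exact hex (excess_le_mul_self hf hOPT.1 hε.le hε1.le (not_lt.1 hcon))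
      have hVpos : 0 < V := by
        refine lt_of_le_of_ne hV0 fun hV => ?_
        have := excess_le_zero (S := S) hf hOPT hV.symm
        rw [← hV] at hnot
        linarith
      rw [div_mul_eq_mul_div, le_div_iff₀ (by positivity)]
      linarith
  have hsum := sum_expect_walk_le hf hE hr hb ht hm htk hκ hOPT.2 (N + 1) S hS
  rw [attempt, expect, div_le_iff₀ (by positivity)]
  have h1 : ∀ j : Fin (N + 1), ((walk b t m k j S).bind (verify ε)).expect f M failure ≤
      3 / (ε * V) * (walk b t m k j S).expect f M (excess f M) := by
    intro j
    rw [expect_bind, ← add_zero (3 / (ε * V) * _), ← expect_affine]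
    exact expect_le_expect (spec_walk hf hE hb ht m k j S hS).2 fun S' hS' => by
      linarith [hver S' hS']
  refine (Finset.sum_le_sum fun j _ => h1 j).trans ?_
  rw [← Finset.mul_sum, Fin.sum_univ_eq_sum_range
    (fun j => (walk b t m k j S).expect f M (excess f M)) (N + 1)]
  set E := ∑ j ∈ Finset.range (N + 1), (walk b t m k j S).expect f M (excess f M)
  have h2 : κ * E ≤ V := by linarith [hf.nonneg S]
  -- For V = 0 the factor 3 / (ε V) is 0 by convention; `hver` remains true since the excess then
  -- vanishes and verification never fails.
  rcases hV0.eq_or_lt with hV | hV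
  · rw [← hV]
    simp only [mul_zero, div_zero, zero_mul]
    positivity
  · rw [div_mul_eq_mul_div, div_le_iff₀ (by positivity)]
    have h3 : 6 * (κ * E) ≤ κ * ε * (N + 1) * V := by nlinarith
    have h4 : κ * (6 * E) ≤ κ * (ε * (N + 1) * V) := by linarith
    have := le_of_mul_le_mul_left h4 hκ0
    linarith

theorem spec_attempt (hf : IsNonnegMonotoneSubmodular f) (hE : M.E = Set.univ)
    {b t : ℕ} (hb : Fintype.card α ≤ 2 ^ b) (ht : 0 < t) (m k N : ℕ) {ε : ℝ} (hε : 0 ≤ ε)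
    {OPT : Finset α} (hOPT : IsOptimal M f OPT) (hS : M.IsBase (S : Set α)) :
    Spec f M (N * (t + k * (b + 2) + 1) + (3 * Fintype.card α + 1))
      (fun o => o = none ∨ ∃ S, o = some S ∧ IsApproxLocalOpt M f (ε * f OPT) S)
      (attempt ε b t m k N S) := by
  refine Spec.coin fun j => Spec.bind
    ((spec_walk hf hE hb ht m k j S hS).mono
      (Nat.mul_le_mul_right _ (Nat.lt_succ_iff.1 j.2)) fun _ => id) fun S' hS' =>
    (spec_verify hf hE ε S').mono le_rfl ?_
  rintro o rfl
  split_ifs with h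
  · exact Or.inr ⟨S', rfl, isApproxLocalOpt_of_excess_le hS'.indep
      (h.trans (mul_le_mul_of_nonneg_left (hOPT.2 S' hS'.indep) hε))⟩
  · exact Or.inl rfl

end randomized

end OracleAlg

/-! ### Parameters, query count and success probability of the randomized algorithm. -/

namespace OracleAlg

section randomized

/-- The choice of `t` balances rt ≤ r√n against rk: if `n.sqrt ≤ r` then k ≤ 2√n, and otherwise t =
r gives rk ≤ n. The constant is 1777 = 1 + 3(49 · 12 + 4). -/
theorem randomizedSearch_bound {n r : ℕ} (hr : 0 < r) (hrn : r ≤ n) {ε : ℝ} (hε : 0 < ε)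
    (hε1 : ε < 1) {t k : ℕ} (ht : t = min n.sqrt r) (hk : k = n / t) :
    ((n + Nat.clog 2 ⌈ε⁻¹⌉₊ * (⌈48 * r / ε⌉₊ * (t + k * (Nat.clog 2 n + 2) + 1) +
      (3 * n + 1)) : ℕ) : ℝ) ≤ softBound 1777 2 (ε⁻¹ * ((n : ℝ) + r * √(n : ℝ))) := by
  have hn : 0 < n := hr.trans_le hrn
  have hn1 : (1 : ℝ) ≤ n := by exact_mod_cast hn
  have hr1 : (1 : ℝ) ≤ r := by exact_mod_cast hr
  have hi1 : 1 ≤ ε⁻¹ := (one_le_inv₀ hε).2 hε1.le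
  have hs1 : 1 ≤ √(n : ℝ) := Real.one_le_sqrt.2 hn1
  have hsq : √(n : ℝ) * √(n : ℝ) = n := Real.mul_self_sqrt (by linarith)
  set s := √(n : ℝ)
  set H : ℝ := n + r * s with hH
  have hrs : (r : ℝ) ≤ r * s := le_mul_of_one_le_right (by linarith) hs1
  have hnH : (n : ℝ) ≤ H := by rw [hH]; linarith
  have hH1 : 1 ≤ H := hn1.trans hnH
  set g : ℝ := ε⁻¹ * H with hg
  have hHg : H ≤ g := le_mul_of_one_le_left (by linarith) hi1
  have hig : ε⁻¹ ≤ g := le_mul_of_one_le_right (by linarith) hH1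
  have hg1 : 1 ≤ g := hH1.trans hHg
  have hL := one_le_log_two_add hg1
  have hb := clog_le_log_two_add hg1 (n := n) (by linarith)
  have hK := clog_le_log_two_add hg1 (n := ⌈ε⁻¹⌉₊)
    (by linarith [Nat.ceil_lt_add_one (a := ε⁻¹) (by positivity)])
  have hb0 : (0 : ℝ) ≤ Nat.clog 2 n := Nat.cast_nonneg _
  have hK0 : (0 : ℝ) ≤ Nat.clog 2 ⌈ε⁻¹⌉₊ := Nat.cast_nonneg _
  rw [softBound]
  set L := Real.log (2 + g)
  have hsqrt : 0 < n.sqrt := Nat.sqrt_pos.2 hn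
  have hts : (t : ℝ) ≤ s := by
    refine le_trans ?_ (Real.nat_sqrt_le_real_sqrt)
    rw [ht]
    exact_mod_cast min_le_left _ _
  have hrk : (r : ℝ) * k ≤ 2 * (r * s) + n := by
    have hkt : (k : ℝ) * t ≤ n := by
      rw [hk]
      exact_mod_cast Nat.div_mul_le_self n t
    rcases le_total n.sqrt r with hle | hle
    · rw [min_eq_left hle] at ht
      have h1 : s ≤ 2 * t := by
        have h2 : s ≤ n.sqrt + 1 := Real.real_sqrt_le_nat_sqrt_succ
        have h3 : (1 : ℝ) ≤ n.sqrt := by exact_mod_cast hsqrt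
        rw [ht]
        linarith
      have h4 : (k : ℝ) * s ≤ 2 * s * s := by
        have : (k : ℝ) * s ≤ k * (2 * t) := by gcongr
        nlinarith
      have h5 : (k : ℝ) ≤ 2 * s := le_of_mul_le_mul_right h4 (by linarith)
      have : (r : ℝ) * k ≤ r * (2 * s) := by gcongr
      linarith
    · rw [min_eq_right hle] at ht
      rw [ht] at hkt
      nlinarith
  set b : ℝ := (Nat.clog 2 n : ℝ)
  set K : ℝ := (Nat.clog 2 ⌈ε⁻¹⌉₊ : ℝ)
  have hN : (⌈48 * r / ε⌉₊ : ℝ) ≤ 49 * (ε⁻¹ * r) := by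
    have h1 : (⌈48 * r / ε⌉₊ : ℝ) < 48 * r / ε + 1 := Nat.ceil_lt_add_one (by positivity)
    have h2 : 48 * r / ε = 48 * (ε⁻¹ * r) := by rw [div_eq_inv_mul]; ring
    have h3 : 1 ≤ ε⁻¹ * r := one_le_mul_of_one_le_of_one_le hi1 hr1
    linarith
  have hstep : (r : ℝ) * (t + k * (b + 2) + 1) ≤ H * (2 * b + 6) := by
    have h1 : (r : ℝ) * t ≤ r * s := by gcongr
    have h2 : (r : ℝ) * k * (b + 2) ≤ (2 * (r * s) + n) * (b + 2) := by gcongr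
    have h3 : (n : ℝ) * (b + 2) ≤ n * (2 * b + 6) := by gcongr <;> linarith
    rw [hH]
    nlinarith
  push_cast
  calc (n : ℝ) + K * (⌈48 * r / ε⌉₊ * (t + k * (b + 2) + 1) + (3 * n + 1))
      ≤ g + K * (49 * (ε⁻¹ * r) * (t + k * (b + 2) + 1) + (3 * g + g)) := by
        gcongr <;> linarith
    _ = g + K * (49 * ε⁻¹ * (r * (t + k * (b + 2) + 1)) + 4 * g) := by ring
    _ ≤ g + K * (49 * ε⁻¹ * (H * (2 * b + 6)) + 4 * g) := by gcongr
    _ = g + K * (g * (49 * (2 * b + 6) + 4)) := by rw [hg]; ring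
    _ ≤ g + 3 * L * (g * (49 * (2 * (3 * L) + 6 * L) + 4 * L)) := by
        have : (0 : ℝ) ≤ g := by linarith
        gcongr <;> linarith
    _ ≤ g * L ^ 2 + 3 * L * (g * (49 * (2 * (3 * L) + 6 * L) + 4 * L)) := by
        gcongr
        exact le_mul_of_one_le_right (by linarith) (one_le_pow₀ hL)
    _ = 1777 * g * L ^ 2 := by ring

/-- Each of the two integer divisions loses at most a factor 2, which with the 2 already present
gives 1/(8r). This is why 48r/ε steps suffice: 48/8 = 6. -/
theorem randomizedSearch_rate {n r : ℕ} (hr : 0 < r) (hrn : r ≤ n) {t k : ℕ}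
    (ht : t = min n.sqrt r) (hk : k = n / t) :
    0 < t ∧ r ≤ (r / t + 1) * t ∧ t * k ≤ n ∧
      1 / (8 * (r : ℝ)) ≤ k / (2 * n * ((r / t : ℕ) + 1)) := by
  have hn : 0 < n := hr.trans_le hrn
  have ht0 : 0 < t := by
    rw [ht]
    exact lt_min (Nat.sqrt_pos.2 hn) hr
  have htr : t ≤ r := ht ▸ min_le_right _ _
  have htk : t * k ≤ n := hk ▸ Nat.mul_div_le n t
  have hnk : n ≤ 2 * (t * k) := by
    have h1 : n < t * (k + 1) := by
      rw [hk]
      exact Nat.lt_mul_div_succ n ht0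
    have h2 : 1 ≤ k := by
      rw [hk]
      exact Nat.div_pos (htr.trans hrn) ht0
    nlinarith
  refine ⟨ht0, ?_, htk, ?_⟩
  · rw [mul_comm]
    exact (Nat.lt_mul_div_succ r ht0).le
  · have h1 : (r / t + 1) * t ≤ 2 * r := by
      have := Nat.div_mul_le_self r t
      nlinarith
    have h1' : (((r / t : ℕ) : ℝ) + 1) * t ≤ 2 * r := by exact_mod_cast h1
    have hnk' : (n : ℝ) ≤ 2 * (t * k) := by exact_mod_cast hnk
    have hnpos : (0 : ℝ) < n := by exact_mod_cast hn
    have hrpos : (0 : ℝ) < r := by exact_mod_cast hr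
    rw [div_le_div_iff₀ (by positivity) (by positivity)]
    calc 1 * (2 * (n : ℝ) * ((r / t : ℕ) + 1))
        ≤ 1 * (2 * (2 * (t * k)) * ((r / t : ℕ) + 1)) := by gcongr
      _ = 4 * k * ((((r / t : ℕ) : ℝ) + 1) * t) := by ring
      _ ≤ 4 * k * (2 * r) := by gcongr
      _ = k * (8 * r) := by ring

variable {α : Type u} [Fintype α] [DecidableEq α] [Nonempty α] {f : Finset α → ℝ} {M : Matroid α}

theorem spec_randomizedSearch (hf : IsNonnegMonotoneSubmodular f) (hE : M.E = Set.univ) {r : ℕ}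
    (hr : M.eRank = (r : ℕ∞)) {ε : ℝ} (hε : 0 < ε) (hε1 : ε < 1) {OPT : Finset α}
    (hOPT : IsOptimal M f OPT) :
    ((randomizedSearch α ε).queries f M : ℝ) ≤
        softBound 1777 2 (ε⁻¹ * ((Fintype.card α : ℝ) + r * √(Fintype.card α : ℝ))) ∧
      (randomizedSearch α ε).Ensures f M
        (fun o => o = none ∨ ∃ S, o = some S ∧ IsApproxLocalOpt M f (ε * f OPT) S) ∧
      (randomizedSearch α ε).expect f M failure ≤ ε := by
  have hδ : 0 ≤ ε * f OPT := mul_nonneg hε.le (hf.nonneg _)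
  have hbase := spec_findBase (f := f) (M := M)
  -- In rank 0 the block size would be 0, but the empty base already has the required property.
  rcases Nat.eq_zero_or_pos r with rfl | hrpos
  · have hspec : Spec f M (Fintype.card α + 0)
        (fun o => ∃ S, o = some S ∧ IsApproxLocalOpt M f (ε * f OPT) S)
        (randomizedSearch α ε) := by
      refine Spec.bind hbase fun B hB => ?_
      rw [if_pos (hB.finset_card_eq hr)]
      exact Spec.done _ ⟨B, rfl, isApproxLocalOpt_of_rank_zero hf hE hr hB hδ⟩
    refine ⟨?_, hspec.2.mono fun o => Or.inr, ?_⟩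
    · refine (Nat.cast_le.2 hspec.1).trans ?_
      have hn1 : (1 : ℝ) ≤ Fintype.card α := by exact_mod_cast Fintype.card_pos (α := α)
      have hi1 : 1 ≤ ε⁻¹ := (one_le_inv₀ hε).2 hε1.le
      rw [softBound, Nat.cast_zero, zero_mul, add_zero, add_zero]
      have hg : (Fintype.card α : ℝ) ≤ ε⁻¹ * Fintype.card α :=
        le_mul_of_one_le_left (by linarith) hi1
      have hL := one_le_pow₀ (n := 2) (one_le_log_two_add (hn1.trans hg))
      nlinarith
    · refine le_trans (expect_le_expect hspec.2 (g' := fun _ => ε) ?_) (expect_const _ _).le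
      rintro o ⟨S, rfl, -⟩
      exact hε.le
  · have hrn : r ≤ Fintype.card α := by
      obtain ⟨B, hB⟩ := M.exists_isBase
      lift B to Finset α using Set.toFinite B
      rw [← hB.finset_card_eq hr]
      exact Finset.card_le_univ B
    obtain ⟨ht, hm, htk, hκ⟩ := randomizedSearch_rate hrpos hrn rfl rfl
    have hb : Fintype.card α ≤ 2 ^ Nat.clog 2 (Fintype.card α) := Nat.le_pow_clog one_lt_two _
    have hspec := Spec.bind (Q := fun o => o = none ∨
        ∃ S, o = some S ∧ IsApproxLocalOpt M f (ε * f OPT) S)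
      (k := fun B => if B.card = 0 then done (some B)
        else retry (attempt ε (Nat.clog 2 (Fintype.card α))
          (min (Fintype.card α).sqrt B.card) (B.card / min (Fintype.card α).sqrt B.card)
          (Fintype.card α / min (Fintype.card α).sqrt B.card) ⌈48 * B.card / ε⌉₊ B)
          (Nat.clog 2 ⌈ε⁻¹⌉₊)) hbase fun B hB => by
        rw [hB.finset_card_eq hr, if_neg hrpos.ne']
        exact spec_retry (spec_attempt hf hE hb ht _ _ _ hε.le hOPT hB) _
    refine ⟨(Nat.cast_le.2 hspec.1).trans
      (randomizedSearch_bound hrpos hrn hε hε1 rfl rfl), hspec.2, ?_⟩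
    rw [randomizedSearch, expect_bind]
    refine le_trans (expect_le_expect hbase.2 (g' := fun _ => ε) fun B hB => ?_)
      (expect_const _ _).le
    rw [hB.finset_card_eq hr, if_neg hrpos.ne']
    have hrpos' : (0 : ℝ) < r := by exact_mod_cast hrpos
    refine (expect_failure_retry_le (by norm_num) (expect_failure_attempt_le hf hE hr hb ht hm htk
      (by positivity) hκ hε hε1 ?_ hB) _).trans ?_
    · have h1 : 48 * r / ε ≤ ⌈48 * r / ε⌉₊ := Nat.le_ceil _
      rw [div_le_iff₀ hε] at h1
      rw [div_mul_eq_mul_div, div_mul_eq_mul_div, le_div_iff₀ (by positivity)]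
      linarith
    -- The number K of attempts satisfies 2^K ≥ 1/ε, so all of them fail with probability at most ε.
    · have h1 : ε⁻¹ ≤ ⌈ε⁻¹⌉₊ := Nat.le_ceil _
      have h2 : ((⌈ε⁻¹⌉₊ : ℕ) : ℝ) ≤ 2 ^ Nat.clog 2 ⌈ε⁻¹⌉₊ := by
        exact_mod_cast Nat.le_pow_clog one_lt_two ⌈ε⁻¹⌉₊
      rw [one_div, inv_pow]
      exact inv_le_of_inv_le₀ hε (h1.trans h2)

end randomized

theorem one_sub_le_toOuterMeasure_output {α : Type u} {β : Type u} {f : Finset α → ℝ}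
    {M : Matroid α} {A : OracleAlg α (Option β)} {P : β → Prop} {ε : ℝ}
    (hA : A.Ensures f M fun o => o = none ∨ ∃ S, o = some S ∧ P S)
    (hfail : A.expect f M (fun o => o.elim 1 fun _ => 0) ≤ ε) :
    ENNReal.ofReal (1 - ε) ≤ (A.output f M).toOuterMeasure {o | ∃ S, o = some S ∧ P S} := by
  classical
  rw [toOuterMeasure_output]
  refine ENNReal.ofReal_le_ofReal ?_
  have h := expect_le_expect hA
    (g := fun o => -1 * (o.elim 1 fun _ => 0) + 1)
    (g' := fun o => if o ∈ {o | ∃ S, o = some S ∧ P S} then 1 else 0) ?_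
  · rw [expect_affine] at h
    refine le_trans ?_ (h.trans (le_of_eq ?_))
    · linarith
    · congr!
  · rintro o (rfl | ⟨S, rfl, hS⟩)
    · simp
    · simp [hS]

end OracleAlg

theorem isApproxLocalOpt_empty_of_isEmpty {α : Type u} [DecidableEq α] [IsEmpty α] {M : Matroid α}
    {f : Finset α → ℝ} {δ : ℝ} (hδ : 0 ≤ δ) : IsApproxLocalOpt M f δ ∅ :=
  ⟨by simp, fun T _ => by simpa [Finset.eq_empty_of_isEmpty T] using hδ⟩

theorem proposition3 :
    (∃ (C : ℝ) (k : ℕ), ∀ (α : Type u) [Fintype α] [DecidableEq α] (ε : ℝ), 0 < ε → ε < 1 →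
      ∃ A : OracleAlg α (Finset α), A.IsDeterministic ∧
        ∀ (f : Finset α → ℝ) (M : Matroid α) (r : ℕ),
          IsNonnegMonotoneSubmodular f → M.E = Set.univ → M.eRank = (r : ℕ∞) →
          (A.queries f M : ℝ) ≤
            softBound C k (ε⁻¹ * ((Fintype.card α : ℝ) * (max r 1 : ℕ))) ∧
          ∃ S : Finset α, A.output f M = PMF.pure S ∧
            ∀ OPT : Finset α, IsOptimal M f OPT → IsApproxLocalOpt M f (ε * f OPT) S) ∧
    (∃ (C : ℝ) (k : ℕ), ∀ (α : Type u) [Fintype α] [DecidableEq α] (ε : ℝ), 0 < ε → ε < 1 →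
      ∃ A : OracleAlg α (Option (Finset α)),
        ∀ (f : Finset α → ℝ) (M : Matroid α) (r : ℕ),
          IsNonnegMonotoneSubmodular f → M.E = Set.univ → M.eRank = (r : ℕ∞) →
          (A.queries f M : ℝ) ≤
            softBound C k (ε⁻¹ * ((Fintype.card α : ℝ) + r * √(Fintype.card α : ℝ))) ∧
          ∀ OPT : Finset α, IsOptimal M f OPT →
            ENNReal.ofReal (1 - ε) ≤ (A.output f M).toOuterMeasure
              {o | ∃ S : Finset α, o = some S ∧ IsApproxLocalOpt M f (ε * f OPT) S} ∧
            ∀ o ∈ (A.output f M).support,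
              o = none ∨ ∃ S : Finset α, o = some S ∧ IsApproxLocalOpt M f (ε * f OPT) S) := by
  refine ⟨⟨25, 1, fun α _ _ ε hε hε1 => ?_⟩, ⟨1777, 2, fun α _ _ ε hε hε1 => ?_⟩⟩
  -- On an empty ground set the query bound is 0, so not a single query is allowed and the empty set
  -- is returned at once.
  · rcases isEmpty_or_nonempty α with hα | hα
    · refine ⟨.done ∅, trivial, fun f M r hf _ _ => ⟨by simp [OracleAlg.queries, softBound],
        ∅, rfl, fun OPT _ => ?_⟩⟩
      exact isApproxLocalOpt_empty_of_isEmpty (mul_nonneg hε.le (hf.nonneg _))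
    · refine ⟨OracleAlg.deterministicSearch α ε, OracleAlg.isDeterministic_deterministicSearch ε,
        fun f M r hf hE hr => ?_⟩
      have hspec := OracleAlg.spec_deterministicSearch hf hE hr hε
      exact ⟨(Nat.cast_le.2 hspec.1).trans (OracleAlg.deterministicSearch_bound
          Fintype.card_pos hε hε1),
        (OracleAlg.isDeterministic_deterministicSearch ε).exists_output_eq_pure hspec.2⟩
  · rcases isEmpty_or_nonempty α with hα | hα
    · refine ⟨.done (some ∅), fun f M r hf _ _ => ⟨by simp [OracleAlg.queries, softBound],
        fun OPT _ => ?_⟩⟩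
      have hens : (OracleAlg.done (some ∅) : OracleAlg α _).Ensures f M
          (fun o => o = none ∨ ∃ S, o = some S ∧ IsApproxLocalOpt M f (ε * f OPT) S) :=
        Or.inr ⟨∅, rfl, isApproxLocalOpt_empty_of_isEmpty (mul_nonneg hε.le (hf.nonneg _))⟩
      exact ⟨OracleAlg.one_sub_le_toOuterMeasure_output hens hε.le,
        fun o ho => hens.of_mem_support ho⟩
    · refine ⟨OracleAlg.randomizedSearch α ε, fun f M r hf hE hr => ⟨?_, fun OPT hOPT => ?_⟩⟩
      · obtain ⟨OPT, hOPT⟩ := exists_isOptimal f M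
        exact (OracleAlg.spec_randomizedSearch hf hE hr hε hε1 hOPT).1
      · obtain ⟨-, hens, hfail⟩ := OracleAlg.spec_randomizedSearch hf hE hr hε hε1 hOPT
        exact ⟨OracleAlg.one_sub_le_toOuterMeasure_output hens hfail,
          fun o ho => hens.of_mem_support ho⟩
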